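/- **Setting.** For $f:\mathbb R^n\to(-\infty,\infty]$ let $\operatorname{dom} f=\{x: f(x)<\infty\}$ and let $f^*(y)=\sup_{x}\,\langle y,x\rangle-f(x)$ be the convex conjugate; let $\delta_C$ be the indicator function of a set $C$ ($0$ on $C$, $+\infty$ off $C$). For proper, convex, lower semicontinuous $f$ and $t\ge 0$, the expression $t f(x/t)$ denotes the perspective of $f$, which for $t=0$ is read as $\delta^*_{\operatorname{dom}(f^*)}(x)$. Let $\operatorname{ri}$ denote the relative interior. A Slater point of $\{x: h_k(x)\le 0\ \forall k\}$ is a point $x$ of this set with $x\in\operatorname{ri}(\operatorname{dom} h_k)$ for all $k$ and $h_k(x)<0$ for every $k$ such that $h_k$ is not an affine function on $\mathbb R^n$. Let $\Theta=\{\theta\in\mathbb R^m: g_l(\theta)\le 0,\ l=1,\dots,L\}$ and $\mathcal Z=\{z\in\mathbb R^d: f_k(z)\le 0,\ k=1,\dots,K\}$ with proper, convex, lower semicontinuous $g_l$ and $f_k$ with values in $(-\infty,\infty]$. Let $c(z,\hat z)\in[0,\infty]$ be defined for $z\in\mathbb R^d$ and $\hat z\in\mathcal Z$ (a cost given on $\mathcal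 Z\times\mathcal Z$ only is extended by $+\infty$), lower semicontinuous in $(z,\hat z)$ and convex in $z$, with $c(z,\hat z)=0$ if and only if $z=\hat z$, for $z,\hat z\in\mathcal Z$. Let $\ell(\theta,z)=\max_{1\le i\le I}\ell_i(\theta,z)$ for $\theta\in\Theta$, $z\in\mathcal Z$, where $\ell_i:\Theta\times\mathbb R^d\to\mathbb R$ is convex and lower semicontinuous in $\theta$ and concave and upper semicontinuous in $z$. Let $\hat{\mathbb P}=\sum_{j=1}^J p_j\delta_{\hat z_j}$ (here $\delta_{\hat z_j}$ is the Dirac measure at $\hat z_j$) with $p_j>0$, $\sum_j p_j=1$, $\hat z_j\in\mathcal Z$. Suppose that, for every $j$, $\hat z_j\in\operatorname{ri}(\operatorname{dom} c(\cdot,\hat z_j))$ and $\hat z_j$ is a Slater point of $\mathcal Z$ in its representation by the $f_k$. Let $\varepsilon>0$. For probability distributions let $d_c(\mathbb Q,\hat{\mathbb P})=\inf_\pi \mathbb E_{(Z,\hat Z)\sim\pi}[c(Z,\hat Z)]$, the infimum being over all couplings $\pi$ of $\mathbb Q$ and $\hat{\mathbb P}$, and let $\mathbb B_\varepsilon(\hat{\mathbb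 P})$ be the set of all probability distributions $\mathbb Q$ supported on $\mathcal Z$ with $d_c(\mathbb Q,\hat{\mathbb P})\le\varepsilon$. Expectations of $\ell$ are integrals of the positive part minus integrals of the negative part, with values in $[-\infty,\infty]$ and the convention $\infty-\infty=-\infty$. **Proposition.** The problem $$\inf_{\theta\in\Theta}\ \sup_{\mathbb Q\in\mathbb B_\varepsilon(\hat{\mathbb P})}\ \mathbb E_{Z\sim\mathbb Q}[\ell(\theta,Z)]$$ has the same infimum in $[-\infty,\infty]$ as the finite-dimensional program $$\begin{array}{cl}\inf & \displaystyle\lambda\varepsilon+\sum_{j=1}^J p_js_j\\ \text{s.t.} & \theta\in\Theta,\ \lambda,\tau_{ijk}\in\mathbb R_+,\ s_j\in\mathbb R,\ \zeta^{\ell}_{ij},\zeta^{c}_{ij},\zeta^{f}_{ijk}\in\mathbb R^d\quad\forall i,j,k,\\ & \displaystyle(-\ell_i)^{*2}(\theta,\zeta^{\ell}_{ij})+\lambda c^{*1}(\zeta^{c}_{ij}/\lambda,\hat z_j)+\sum_{k=1}^K\tau_{ijk}f_k^*(\zeta^{f}_{ijk}/\tau_{ijk})\le s_j\quad\forall i,j,\\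 & \displaystyle\zeta^{\ell}_{ij}+\zeta^{c}_{ij}+\sum_{k=1}^K\zeta^{f}_{ijk}=0\quad\forall i,j,\end{array}$$ where $(-\ell_i)^{*2}(\theta,\cdot)$ is the conjugate of $z\mapsto-\ell_i(\theta,z)$, $c^{*1}(\cdot,\hat z)$ is the conjugate of $z\mapsto c(z,\hat z)$, and the last two kinds of terms in the inequality are perspectives (also for $\lambda=0$ or $\tau_{ijk}=0$). Moreover, this program is convex: its objective function is convex on the whole space, the set of all points with $\theta\in\Theta$ and $\lambda,\tau_{ijk}\ge 0$ is convex, the left-hand sides of its inequality constraints are convex functions on that set, and its feasible set is convex. -/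

import Mathlib

open MeasureTheory
open scoped ENNReal

noncomputable section

/-! ### Extended-real-valued convex analysis -/

/-- The domain of an extended-real-valued function. -/
def effDom {E : Type*} (f : E → EReal) : Set E := {x | f x < ⊤}

/-- A function is proper if it never takes the value `-∞` and is not identically `+∞`. -/
def IsProperFn {E : Type*} (f : E → EReal) : Prop :=
  (∀ x, ⊥ < f x) ∧ (effDom f).Nonempty

/-- `f` is convex on the set `S`: the part of its epigraph above `S` is a convex set. -/
def IsConvexFnOn {E : Type*} [AddCommGroup E] [Module ℝ E] (S : Set E) (f : E → EReal) : Prop :=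
  Convex ℝ {q : E × ℝ | q.1 ∈ S ∧ f q.1 ≤ (q.2 : EReal)}

/-- `f` is a convex function on the whole space. -/
def IsConvexFn {E : Type*} [AddCommGroup E] [Module ℝ E] (f : E → EReal) : Prop :=
  IsConvexFnOn Set.univ f

/-- Proper, convex and lower semicontinuous. -/
structure IsProperConvexLsc {E : Type*} [NormedAddCommGroup E] [InnerProductSpace ℝ E]
    (f : E → EReal) : Prop where
  proper : IsProperFn f
  convex : IsConvexFn f
  lsc : LowerSemicontinuous f

/-- The convex conjugate `f^*(y) = sup_x ⟨y, x⟩ - f(x)`. -/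
def conj {E : Type*} [NormedAddCommGroup E] [InnerProductSpace ℝ E] (f : E → EReal) (y : E) :
    EReal :=
  ⨆ x : E, ((inner ℝ y x : ℝ) : EReal) - f x

open Classical in
/-- The indicator function of a set: `0` on the set and `+∞` off the set. -/
def indicatorFn {E : Type*} (C : Set E) (x : E) : EReal := if x ∈ C then 0 else ⊤

/-- The perspective function of `f`: it is `t f(x / t)` for `t > 0`, and at `t = 0` it is the
conjugate of the indicator function of `dom (f^*)`. Only `t ≥ 0` is meaningful. -/
def perspective {E : Type*} [NormedAddCommGroup E] [InnerProductSpace ℝ E] (f : E → EReal)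
    (x : E) (t : ℝ) : EReal :=
  if 0 < t then (t : EReal) * f (t⁻¹ • x) else conj (indicatorFn (effDom (conj f))) x

/-- The set cut out by the inequalities `h_k(x) ≤ 0`. -/
def constraintSet {E : Type*} {M : ℕ} (h : Fin M → E → EReal) : Set E := {x | ∀ k, h k x ≤ 0}

/-- `h` is a (finite) affine function, that is, the constraint `h ≤ 0` is linear. -/
def IsAffineFn {E : Type*} [NormedAddCommGroup E] [InnerProductSpace ℝ E] (h : E → EReal) : Prop :=
  ∃ (a : E) (b : ℝ), ∀ x, h x = ((inner ℝ a x + b : ℝ) : EReal)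

/-- `x` is a Slater point of the set represented by the inequalities `h_k ≤ 0`: it satisfies them,
it lies in the relative interior of the domain of every `h_k`, and it satisfies every
nonlinear inequality strictly. -/
structure IsSlaterPoint {E : Type*} [NormedAddCommGroup E] [InnerProductSpace ℝ E] {M : ℕ}
    (h : Fin M → E → EReal) (x : E) : Prop where
  mem : x ∈ constraintSet h
  mem_ri : ∀ k, x ∈ intrinsicInterior ℝ (effDom (h k))
  strict : ∀ k, ¬ IsAffineFn (h k) → h k x < 0

/-! ### Optimal transport and the distributionally robust problem -/

/-- The expectation of a real function as an extended real number, the integral of the positive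
part minus that of the negative part. In `EReal` one has `⊤ - ⊤ = ⊥`, so the expectation
is `-∞` if both parts have infinite integral. -/
def expectation {Ω : Type*} [MeasurableSpace Ω] (μ : Measure Ω) (f : Ω → ℝ) : EReal :=
  ((∫⁻ z, ENNReal.ofReal (f z) ∂μ : ℝ≥0∞) : EReal)
    - ((∫⁻ z, ENNReal.ofReal (-f z) ∂μ : ℝ≥0∞) : EReal)

/-- The couplings of `P` and `Q`. -/
def couplings {Ω : Type*} [MeasurableSpace Ω] (P Q : Measure Ω) : Set (Measure (Ω × Ω)) :=
  {π | π.map Prod.fst = P ∧ π.map Prod.snd = Q}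

/-- The optimal transport discrepancy `d_c`. -/
def otDiscrepancy {Ω : Type*} [MeasurableSpace Ω] (c : Ω → Ω → ℝ≥0∞) (P Q : Measure Ω) : ℝ≥0∞ :=
  ⨅ π ∈ couplings P Q, ∫⁻ w, c w.1 w.2 ∂π

/-- The probability distributions supported on `Z` whose discrepancy from `P` is at most `ε`. -/
def ambiguitySet {Ω : Type*} [MeasurableSpace Ω] (Z : Set Ω) (c : Ω → Ω → ℝ≥0∞)
    (P : Measure Ω) (ε : ℝ) : Set (Measure Ω) :=
  {Q | IsProbabilityMeasure Q ∧ Q Zᶜ = 0 ∧ otDiscrepancy c Q P ≤ ENNReal.ofReal ε}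

/-- The discrete distribution `∑_j p_j δ_{ẑ_j}`. -/
def discreteMeasure {Ω : Type*} [MeasurableSpace Ω] {J : ℕ} (p : Fin J → ℝ) (zhat : Fin J → Ω) :
    Measure Ω :=
  ∑ j, ENNReal.ofReal (p j) • Measure.dirac (zhat j)

/-- The optimal value of `inf_{θ ∈ Θ} sup_{Q} E_Q[ℓ(θ, Z)]`, with `Q` in the ambiguity set. -/
def droValue {Ω A : Type*} [MeasurableSpace Ω] (Θ : Set A) (Z : Set Ω) (ℓ : A → Ω → ℝ)
    (c : Ω → Ω → ℝ≥0∞) (P : Measure Ω) (ε : ℝ) : EReal :=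
  ⨅ θ ∈ Θ, ⨆ Q ∈ ambiguitySet Z c P ε, expectation Q (ℓ θ)

/-! ### The finite program -/

/-- The decision variables `(θ, λ, τ, s, ζ^ℓ, ζ^c, ζ^f)`. -/
abbrev PrimalVar (m d I J K : ℕ) : Type :=
  EuclideanSpace ℝ (Fin m) × ℝ × (Fin I → Fin J → Fin K → ℝ) × (Fin J → ℝ) ×
    (Fin I → Fin J → EuclideanSpace ℝ (Fin d)) × (Fin I → Fin J → EuclideanSpace ℝ (Fin d)) ×
    (Fin I → Fin J → Fin K → EuclideanSpace ℝ (Fin d))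

namespace PrimalVar

variable {m d I J K : ℕ}

def theta (x : PrimalVar m d I J K) : EuclideanSpace ℝ (Fin m) := x.1

def lam (x : PrimalVar m d I J K) : ℝ := x.2.1

def tau (x : PrimalVar m d I J K) : Fin I → Fin J → Fin K → ℝ := x.2.2.1

def s (x : PrimalVar m d I J K) : Fin J → ℝ := x.2.2.2.1

def zetaL (x : PrimalVar m d I J K) : Fin I → Fin J → EuclideanSpace ℝ (Fin d) := x.2.2.2.2.1

def zetaC (x : PrimalVar m d I J K) : Fin I → Fin J → EuclideanSpace ℝ (Fin d) := x.2.2.2.2.2.1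

def zetaF (x : PrimalVar m d I J K) : Fin I → Fin J → Fin K → EuclideanSpace ℝ (Fin d) :=
  x.2.2.2.2.2.2

end PrimalVar

/-- The ground set `θ ∈ Θ`, `λ ≥ 0`, `τ_{ijk} ≥ 0`; all other variables are free. -/
def primalGround {m d I J K : ℕ} (Θ : Set (EuclideanSpace ℝ (Fin m))) :
    Set (PrimalVar m d I J K) :=
  {x | x.theta ∈ Θ ∧ 0 ≤ x.lam ∧ ∀ i j k, 0 ≤ x.tau i j k}

/-- The function
`(-ℓ_i)^{*2}(θ, ζ^ℓ_{ij}) + λ c^{*1}(ζ^c_{ij}/λ, ẑ_j) + ∑_k τ_{ijk} f_k^*(ζ^f_{ijk}/τ_{ijk})`. -/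
def primalLHS {m d I J K : ℕ}
    (ℓs : Fin I → EuclideanSpace ℝ (Fin m) → EuclideanSpace ℝ (Fin d) → ℝ)
    (c : EuclideanSpace ℝ (Fin d) → EuclideanSpace ℝ (Fin d) → ℝ≥0∞)
    (f : Fin K → EuclideanSpace ℝ (Fin d) → EReal) (zhat : Fin J → EuclideanSpace ℝ (Fin d))
    (i : Fin I) (j : Fin J) (x : PrimalVar m d I J K) : EReal :=
  conj (fun z => ((-ℓs i x.theta z : ℝ) : EReal)) (x.zetaL i j)
    + perspective (conj fun z => (c z (zhat j) : EReal)) (x.zetaC i j) x.lam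
    + ∑ k, perspective (conj (f k)) (x.zetaF i j k) (x.tau i j k)

/-- The feasible set of the finite program. -/
def primalFeasible {m d I J K : ℕ} (Θ : Set (EuclideanSpace ℝ (Fin m)))
    (ℓs : Fin I → EuclideanSpace ℝ (Fin m) → EuclideanSpace ℝ (Fin d) → ℝ)
    (c : EuclideanSpace ℝ (Fin d) → EuclideanSpace ℝ (Fin d) → ℝ≥0∞)
    (f : Fin K → EuclideanSpace ℝ (Fin d) → EReal) (zhat : Fin J → EuclideanSpace ℝ (Fin d)) :
    Set (PrimalVar m d I J K) :=
  {x | x ∈ primalGround Θ ∧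
    (∀ i j, primalLHS ℓs c f zhat i j x ≤ (x.s j : EReal)) ∧
    ∀ i j, x.zetaL i j + x.zetaC i j + ∑ k, x.zetaF i j k = 0}

/-- The objective function `λ ε + ∑_j p_j s_j`. -/
def primalObjective {m d I J K : ℕ} (ε : ℝ) (p : Fin J → ℝ) (x : PrimalVar m d I J K) : ℝ :=
  x.lam * ε + ∑ j, p j * x.s j

end

/-! For fixed θ the theorem is Lagrangian duality applied twice. The outer duality prices the
transport budget: up to approximation, a distribution in the ambiguity set spreads the mass `p j`
from `zhat j` over `Z`, and pricing the average cost with λ leaves, for each `j`, a bound `s j` on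
ℓ(θ,z) - λ c(z,ẑ_j) over z ∈ Z. Leaving all mass in place costs 0 < ε, so a multiplier exists
(`exists_multiplier_of_expectation_le`); the converse is integration against a coupling
(`expectation_le_of_mem_ambiguitySet`).

The inner duality certifies this bound for each ℓ_i. The functions ℓ_i, c and f_k receive separate
copies of z; τ prices the constraints and the ζ's price the disagreement of the copies. The
Lagrangian then separates into conjugates and perspectives (`exists_conj_add_perspective_le`; the
weak direction is `sub_mul_le_of_conj_add_perspective_le`). Both dualities produce actual
multipliers, so every real v above the worst-case expectation at θ is matched by a feasible point of
value at most v.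

The Slater condition enters through `exists_multipliers`, a purely algebraic multiplier rule based
on the M. Riesz extension theorem. By `perspective_conj_le_iff`, a perspective of a conjugate is,
also at t = 0, a supremum of linear functions over the original domain; this drives both the duality
and the convexity of the program. -/

/-! ### Lagrange multipliers in real vector spaces -/

section Multipliers

variable {V G : Type*} [AddCommGroup V] [Module ℝ V] [AddCommGroup G] [Module ℝ G]

/-- `x₀` is a relative algebraic interior point of `D`: every segment of `D` ending in `x₀` can be
prolonged within `D`. -/
def IsCorePoint (D : Set V) (x₀ : V) : Prop :=
  x₀ ∈ D ∧ ∀ x ∈ D, ∃ r : ℝ, 0 < r ∧ x₀ + r • (x₀ - x) ∈ D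

/-- `T` respects the convex combinations of points of `D`. -/
def IsAffineOn (D : Set V) (T : V → G) : Prop :=
  ∀ x ∈ D, ∀ y ∈ D, ∀ a b : ℝ, 0 ≤ a → 0 ≤ b → a + b = 1 → T (a • x + b • y) = a • T x + b • T y

theorem IsAffineOn.mono {D D' : Set V} {T : V → G} (h : IsAffineOn D T) (hD : D' ⊆ D) :
    IsAffineOn D' T :=
  fun x hx y hy => h x (hD hx) y (hD hy)

theorem LinearMap.isAffineOn (T : V →ₗ[ℝ] G) (D : Set V) : IsAffineOn D T :=
  fun x _ y _ a b _ _ _ => by simp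

theorem IsAffineOn.convexOn {D : Set V} {T : V → ℝ} (hD : Convex ℝ D) (h : IsAffineOn D T) :
    ConvexOn ℝ D T :=
  ⟨hD, fun x hx y hy a b ha hb hab => (h x hx y hy a b ha hb hab).le⟩

theorem IsAffineOn.convex_zero {D : Set V} {T : V → G} (hD : Convex ℝ D) (h : IsAffineOn D T) :
    Convex ℝ {x ∈ D | T x = 0} := by
  intro x hx y hy a b ha hb hab
  refine ⟨hD hx.1 hy.1 ha hb hab, ?_⟩
  rw [h x hx.1 y hy.1 a b ha hb hab, hx.2, hy.2]
  simp

/-- The two-point decomposition of `x₀` between a point and its prolongation. -/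
theorem combo_prolong (x₀ x : V) {r : ℝ} (hr : 0 < r) :
    (r / (1 + r)) • x + (1 / (1 + r)) • (x₀ + r • (x₀ - x)) = x₀ := by
  have h1 : (1 : ℝ) + r ≠ 0 := by positivity
  have : (r / (1 + r)) • x + (1 / (1 + r)) • (x₀ + r • (x₀ - x))
      = (1 / (1 + r) + r / (1 + r)) • x₀ := by
    rw [div_eq_mul_one_div r]
    module
  rw [this, ← add_div, div_self h1, one_smul]

/-- Because `x₀` is a convex combination of `x` and the prolonged point, `T x₀ = 0` forces opposite
values on the two sides. -/
theorem IsAffineOn.apply_prolong {D : Set V} {T : V → G} (h : IsAffineOn D T) {x₀ x : V}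
    (hT : T x₀ = 0) (hx : x ∈ D) {r : ℝ} (hr : 0 < r) (hy : x₀ + r • (x₀ - x) ∈ D) :
    T (x₀ + r • (x₀ - x)) = -(r • T x) := by
  have h1 : (1 : ℝ) + r ≠ 0 := by positivity
  have h2 := h x hx _ hy (r / (1 + r)) (1 / (1 + r)) (by positivity) (by positivity)
    (by rw [← add_div, add_comm r, div_self h1])
  rw [combo_prolong x₀ x hr, hT] at h2
  have h3 : (1 + r) • ((r / (1 + r)) • T x + (1 / (1 + r)) • T (x₀ + r • (x₀ - x))) = 0 := by
    rw [← h2, smul_zero]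
  rw [smul_add, smul_smul, smul_smul, mul_div_cancel₀ _ h1, mul_div_cancel₀ _ h1, one_smul] at h3
  exact (neg_eq_of_add_eq_zero_right h3).symm

/-- A convex set contains a shorter prolongation whenever it contains a longer one. -/
theorem Convex.prolong_mem {D : Set V} (hD : Convex ℝ D) {x₀ x : V} (h₀ : x₀ ∈ D) {r s : ℝ}
    (hs : 0 ≤ s) (hs1 : s ≤ 1) (h : x₀ + r • (x₀ - x) ∈ D) : x₀ + (s * r) • (x₀ - x) ∈ D := by
  have := hD h₀ h (sub_nonneg.2 hs1) hs (by ring)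
  convert this using 1
  module

theorem IsCorePoint.zero_set {D : Set V} {T : V → G} (h : IsAffineOn D T) {x₀ : V}
    (hx₀ : IsCorePoint D x₀) (hT : T x₀ = 0) : IsCorePoint {x ∈ D | T x = 0} x₀ := by
  refine ⟨⟨hx₀.1, hT⟩, fun x hx => ?_⟩
  obtain ⟨r, hr, hy⟩ := hx₀.2 x hx.1
  exact ⟨r, hr, hy, by rw [h.apply_prolong hT hx.1 hr hy, hx.2]; simp⟩

theorem IsCorePoint.sublevel {D : Set V} {h : V → ℝ} (hh : ConvexOn ℝ D h) {x₀ : V}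
    (hx₀ : IsCorePoint D x₀) (hlt : h x₀ < 0) : IsCorePoint {x ∈ D | h x ≤ 0} x₀ := by
  refine ⟨⟨hx₀.1, hlt.le⟩, fun x hx => ?_⟩
  obtain ⟨r, hr, hy⟩ := hx₀.2 x hx.1
  set y := x₀ + r • (x₀ - x) with hyd
  -- This factor solves `h x₀ + s * (|h y| - h x₀) = 0`, so convexity gives `h ≤ 0` at the shortened
  -- prolongation.
  set s : ℝ := -h x₀ / (|h y| + -h x₀) with hs
  have hden : 0 < |h y| + -h x₀ := by have := abs_nonneg (h y); linarith
  have hs0 : 0 < s := div_pos (by linarith) hden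
  have hs1 : s ≤ 1 := (div_le_one hden).2 (by have := abs_nonneg (h y); linarith)
  refine ⟨s * r, mul_pos hs0 hr, hh.1.prolong_mem hx₀.1 hs0.le hs1 hy, ?_⟩
  have h1 := hh.2 hx₀.1 hy (sub_nonneg.2 hs1) hs0.le (by ring)
  have h2 : (1 - s) • x₀ + s • y = x₀ + (s * r) • (x₀ - x) := by rw [hyd]; module
  rw [h2, smul_eq_mul, smul_eq_mul] at h1
  refine h1.trans ?_
  have h3 : s * (|h y| + -h x₀) = -h x₀ := div_mul_cancel₀ _ hden.ne'
  nlinarith [le_abs_self (h y)]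

theorem IsCorePoint.combo {D : Set V} (hD : Convex ℝ D) {x₀ x₁ : V}
    (hx₀ : IsCorePoint D x₀) (hx₁ : x₁ ∈ D) {a b : ℝ} (ha : 0 < a) (hb : 0 ≤ b) (hab : a + b = 1) :
    IsCorePoint D (a • x₀ + b • x₁) := by
  refine ⟨hD hx₀.1 hx₁ ha.le hb hab, fun x hx => ?_⟩
  obtain ⟨r, hr, hy⟩ := hx₀.2 x hx
  have hden : 0 < 1 + b * r := by positivity
  -- The new endpoint is where the segment from `x₀ + r • (x₀ - x)` to `x₁` meets the ray from `x`
  -- through `a • x₀ + b • x₁`; this determines the length and the weights below.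
  refine ⟨a * r / (1 + b * r), by positivity, ?_⟩
  have h1 := hD hy hx₁ (a := a / (1 + b * r))
    (b := b * (1 + r) / (1 + b * r)) (by positivity) (by positivity) (by
      have : a = 1 - b := by linarith
      rw [this]; field_simp; ring)
  convert h1 using 1
  have hba : b = 1 - a := by linarith
  subst hba
  match_scalars <;> field_simp <;> ring

/-- The multiplier rule for one convex constraint with a strictly feasible point. -/
theorem exists_multiplier_of_strict {D : Set V} {φ h : V → ℝ} (hφ : ConvexOn ℝ D φ)
    (hh : ConvexOn ℝ D h) {x₀ : V} (hx₀ : x₀ ∈ D) (hlt : h x₀ < 0)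
    (hnn : ∀ x ∈ D, h x ≤ 0 → 0 ≤ φ x) :
    ∃ τ : ℝ, 0 ≤ τ ∧ ∀ x ∈ D, 0 ≤ φ x + τ * h x := by
  -- The weights make the values of `h` cancel, so `φ` is nonnegative at the combination: every
  -- lower bound on the multiplier lies below every upper bound.
  have key : ∀ x ∈ D, 0 < h x → ∀ y ∈ D, h y < 0 → -φ x / h x ≤ φ y / -h y := by
    intro x hx hxp y hy hyn
    have hden : 0 < h x - h y := by linarith
    have hsum : -h y / (h x - h y) + h x / (h x - h y) = 1 := by
      rw [← add_div, div_eq_one_iff_eq hden.ne']; ring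
    have ha : 0 ≤ -h y / (h x - h y) := div_nonneg (by linarith) hden.le
    have hb : 0 ≤ h x / (h x - h y) := div_nonneg hxp.le hden.le
    have h1 := hh.2 hx hy ha hb hsum
    have h2 := hφ.2 hx hy ha hb hsum
    have h3 := hnn _ (hφ.1 hx hy ha hb hsum) (h1.trans (by
      simp only [smul_eq_mul]
      have : -h y / (h x - h y) * h x + h x / (h x - h y) * h y = 0 := by ring
      exact this.le))
    have h4 := h3.trans h2
    simp only [smul_eq_mul] at h4
    have h5 : -h y / (h x - h y) * φ x + h x / (h x - h y) * φ y
        = (-h y * φ x + h x * φ y) / (h x - h y) := by ring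
    rw [h5, le_div_iff₀ hden] at h4
    rw [div_le_div_iff₀ hxp (by linarith)]
    nlinarith
  set S : Set ℝ := insert 0 {r | ∃ x ∈ D, 0 < h x ∧ r = -φ x / h x} with hS
  have hbd : ∀ y ∈ D, h y < 0 → ∀ r ∈ S, r ≤ φ y / -h y := by
    rintro y hy hyn r (rfl | ⟨x, hx, hxp, rfl⟩)
    · exact div_nonneg (hnn y hy hyn.le) (by linarith)
    · exact key x hx hxp y hy hyn
  have hba : BddAbove S := ⟨_, fun r hr => hbd x₀ hx₀ hlt r hr⟩
  refine ⟨sSup S, le_csSup hba (Set.mem_insert _ _), fun x hx => ?_⟩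
  rcases lt_trichotomy (h x) 0 with hn | h0 | hp
  · have h1 : sSup S ≤ φ x / -h x := csSup_le ⟨0, Set.mem_insert _ _⟩ (hbd x hx hn)
    rw [le_div_iff₀ (by linarith)] at h1
    linarith
  · rw [h0, mul_zero, add_zero]
    exact hnn x hx h0.le
  · have h1 : -φ x / h x ≤ sSup S := le_csSup hba (Or.inr ⟨x, hx, hp, rfl⟩)
    rw [div_le_iff₀ hp] at h1
    linarith

/-- The multiplier rule for affine equality constraints at a relative interior point. -/
theorem exists_linear_le_of_nonneg_on_zero {D : Set V} {φ : V → ℝ} (hφ : ConvexOn ℝ D φ)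
    {T : V → G} (hT : IsAffineOn D T) {x₀ : V} (hx₀ : IsCorePoint D x₀) (hT₀ : T x₀ = 0)
    (hnn : ∀ x ∈ D, T x = 0 → 0 ≤ φ x) :
    ∃ η : G →ₗ[ℝ] ℝ, ∀ x ∈ D, η (T x) ≤ φ x := by
  set W : Submodule ℝ G := Submodule.span ℝ (T '' D) with hW
  have hadd : ∀ {t u : ℝ}, 0 < t → 0 < u → ∀ x ∈ D, ∀ y ∈ D, ∃ z ∈ D,
      t • T x + u • T y = (t + u) • T z ∧ (t + u) * φ z ≤ t * φ x + u * φ y := by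
    intro t u ht hu x hx y hy
    have htu : 0 < t + u := by positivity
    have hsum : t / (t + u) + u / (t + u) = 1 := by rw [← add_div, div_self htu.ne']
    have ha : 0 ≤ t / (t + u) := by positivity
    have hb : 0 ≤ u / (t + u) := by positivity
    refine ⟨_, hφ.1 hx hy ha hb hsum, ?_, ?_⟩
    · rw [hT x hx y hy _ _ ha hb hsum, smul_add, smul_smul, smul_smul, mul_div_cancel₀ _ htu.ne',
        mul_div_cancel₀ _ htu.ne']
    · have h1 := mul_le_mul_of_nonneg_left (hφ.2 hx hy ha hb hsum) htu.le
      refine h1.trans_eq ?_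
      simp only [smul_eq_mul]
      field_simp
  -- The cone over `T '' D` is already the whole span, since negative multiples are reached by
  -- prolonging beyond `x₀`. Here the relative interior matters.
  have hspan : ∀ y ∈ W, ∃ t : ℝ, 0 < t ∧ ∃ x ∈ D, y = t • T x := by
    intro y hy
    induction hy using Submodule.span_induction with
    | mem y hy =>
      obtain ⟨x, hx, rfl⟩ := hy
      exact ⟨1, one_pos, x, hx, (one_smul _ _).symm⟩
    | zero => exact ⟨1, one_pos, x₀, hx₀.1, by rw [hT₀, smul_zero]⟩
    | add y z _ _ hy hz =>
      obtain ⟨t, ht, x, hx, rfl⟩ := hy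
      obtain ⟨u, hu, x', hx', rfl⟩ := hz
      obtain ⟨z, hz, h1, -⟩ := hadd ht hu x hx x' hx'
      exact ⟨t + u, by positivity, z, hz, h1⟩
    | smul a y _ hy =>
      obtain ⟨t, ht, x, hx, rfl⟩ := hy
      rcases lt_trichotomy a 0 with ha | rfl | ha
      · obtain ⟨r, hr, hz⟩ := hx₀.2 x hx
        refine ⟨-a * t / r, by have : 0 < -a := by linarith
                               positivity, _, hz, ?_⟩
        rw [hT.apply_prolong hT₀ hx hr hz, smul_neg, smul_smul, smul_smul, ← neg_smul]
        congr 1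
        field_simp
      · exact ⟨1, one_pos, x₀, hx₀.1, by rw [hT₀, smul_zero, zero_smul]⟩
      · exact ⟨a * t, by positivity, x, hx, by rw [smul_smul]⟩
  -- The cone generated by the pairs `(T x, r)` with `φ x ≤ r`, plus a vertical half-line. Riesz
  -- extension carries the second coordinate from `0 × ℝ` to a functional `g` nonnegative on the
  -- cone: `hnn` gives positivity on the axis, `hspan` cofinality. Then `η` extends `-g (·, 0)`.
  let s : PointedCone ℝ (W × ℝ) :=
    { carrier := {q | (q.1 = 0 ∧ 0 ≤ q.2) ∨
        ∃ t : ℝ, 0 < t ∧ ∃ x ∈ D, (q.1 : G) = t • T x ∧ t * φ x ≤ q.2}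
      zero_mem' := Or.inl ⟨rfl, le_rfl⟩
      add_mem' := by
        rintro ⟨y, r⟩ ⟨z, r'⟩ (⟨h1, h2⟩ | ⟨t, ht, x, hx, h1, h2⟩)
          (⟨h3, h4⟩ | ⟨u, hu, x', hx', h3, h4⟩)
        · exact Or.inl ⟨by simp_all, by simp at *; linarith⟩
        · simp only at h1 h2 h3 h4
          exact Or.inr ⟨u, hu, x', hx', by simp [h1, h3], by simp; linarith⟩
        · simp only at h1 h2 h3 h4
          exact Or.inr ⟨t, ht, x, hx, by simp [h1, h3], by simp; linarith⟩
        · simp only at h1 h2 h3 h4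
          obtain ⟨z, hz, h5, h6⟩ := hadd ht hu x hx x' hx'
          exact Or.inr ⟨t + u, by positivity, z, hz, by simp [h1, h3, h5], by simp; linarith⟩
      smul_mem' := by
        rintro ⟨a, ha⟩ ⟨y, r⟩ h
        rcases ha.eq_or_lt with rfl | ha'
        · left
          constructor
          · exact zero_smul ℝ y
          · exact (zero_mul r).ge
        rcases h with ⟨h1, h2⟩ | ⟨t, ht, x, hx, h1, h2⟩
        · simp only at h1 h2
          subst h1
          left
          constructor
          · exact smul_zero a
          · exact mul_nonneg ha h2
        · simp only at h1 h2
          refine Or.inr ⟨a * t, by positivity, x, hx, ?_, ?_⟩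
          · change ((a • y : W) : G) = _
            rw [Submodule.coe_smul, h1, smul_smul]
          · change _ ≤ a * r
            rw [mul_assoc]
            gcongr }
  let P : Submodule ℝ (W × ℝ) := Submodule.prod ⊥ ⊤
  let F : (W × ℝ) →ₗ.[ℝ] ℝ := ⟨P, (LinearMap.snd ℝ W ℝ).comp P.subtype⟩
  obtain ⟨g, hg1, hg2⟩ := riesz_extension s F
    (by
      rintro ⟨⟨y, r⟩, hy⟩ hs
      have hy0 : y = 0 := hy.1
      subst hy0
      change 0 ≤ r
      rcases hs with ⟨-, h2⟩ | ⟨t, ht, x, hx, h1, h2⟩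
      · exact h2
      · have h3 : T x = 0 := by
          have h1' : t • T x = 0 := h1.symm
          exact (smul_eq_zero.1 h1').resolve_left ht.ne'
        exact (mul_nonneg ht.le (hnn x hx h3)).trans h2)
    (by
      rintro ⟨y, r⟩
      obtain ⟨t, ht, x, hx, h⟩ := hspan y y.2
      refine ⟨⟨(0, t * φ x - r), ⟨rfl, trivial⟩⟩, Or.inr ⟨t, ht, x, hx, ?_, ?_⟩⟩
      · simpa using h
      · simp)
  obtain ⟨η, hη⟩ := LinearMap.exists_extend (-(g.comp (LinearMap.inl ℝ W ℝ)))
  refine ⟨η, fun x hx => ?_⟩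
  have hxW : T x ∈ W := Submodule.subset_span ⟨x, hx, rfl⟩
  have h1 : η (T x) = -g (⟨T x, hxW⟩, 0) := by
    have := congrArg (fun l => l ⟨T x, hxW⟩) hη
    simpa using this
  have h2 : 0 ≤ g (⟨T x, hxW⟩, φ x) :=
    hg2 _ (Or.inr ⟨1, one_pos, x, hx, by simp, by simp⟩)
  have h3 : g ((0 : W), φ x) = φ x := hg1 ⟨(0, φ x), ⟨rfl, trivial⟩⟩
  have h4 : ((⟨T x, hxW⟩ : W), φ x) = (⟨T x, hxW⟩, 0) + (0, φ x) := by simp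
  rw [h4, map_add, h3] at h2
  rw [h1]
  linarith

/-- An affine function that is nonnegative on `D` and vanishes at a relative interior point
vanishes on `D`. -/
theorem IsCorePoint.eq_zero_of_nonneg {D : Set V} {T : V → ℝ} (h : IsAffineOn D T) {x₀ : V}
    (hx₀ : IsCorePoint D x₀) (hT : T x₀ = 0) (hnn : ∀ x ∈ D, 0 ≤ T x) {x : V} (hx : x ∈ D) :
    T x = 0 := by
  obtain ⟨r, hr, hy⟩ := hx₀.2 x hx
  have h1 := hnn _ hy
  rw [h.apply_prolong hT hx hr hy, smul_eq_mul] at h1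
  have h2 := hnn x hx
  nlinarith

theorem isAffineOn_add_sum {ι : Type*} {D : Set V} {T : V → ℝ} (hT : IsAffineOn D T)
    (S : Finset ι) (σ : ι → ℝ) {h : ι → V → ℝ}
    (hh : ∀ k ∈ S, σ k ≠ 0 → IsAffineOn D (h k)) :
    IsAffineOn D (fun x => T x + ∑ k ∈ S, σ k * h k x) := by
  intro x hx y hy a b ha hb hab
  simp only [smul_eq_mul, mul_add, Finset.mul_sum]
  rw [hT x hx y hy a b ha hb hab, smul_eq_mul, smul_eq_mul, add_add_add_comm,
    ← Finset.sum_add_distrib]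
  congr 1
  refine Finset.sum_congr rfl fun k hk => ?_
  by_cases h0 : σ k = 0
  · simp [h0]
  · rw [hh k hk h0 x hx y hy a b ha hb hab, smul_eq_mul, smul_eq_mul]
    ring

theorem convexOn_add_sum {ι : Type*} {D : Set V} {φ : V → ℝ} (hφ : ConvexOn ℝ D φ)
    (S : Finset ι) {τ : ι → ℝ} (hτ : ∀ k, 0 ≤ τ k) {h : ι → V → ℝ}
    (hh : ∀ k ∈ S, ConvexOn ℝ D (h k)) :
    ConvexOn ℝ D (fun x => φ x + ∑ k ∈ S, τ k * h k x) := by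
  refine ⟨hφ.1, fun x hx y hy a b ha hb hab => ?_⟩
  simp only [smul_eq_mul, mul_add, Finset.mul_sum]
  rw [add_add_add_comm, ← Finset.sum_add_distrib]
  refine add_le_add (hφ.2 hx hy ha hb hab) (Finset.sum_le_sum fun k hk => ?_)
  have := mul_le_mul_of_nonneg_left ((hh k hk).2 hx hy ha hb hab) (hτ k)
  simp only [smul_eq_mul] at this
  linarith

open Classical in
/-- **Lagrange multipliers under a refined Slater condition**: the base point is feasible,
lies in the relative algebraic interior of `D` and satisfies every constraint that is not affine
on `D` strictly. -/
theorem exists_multipliers {ι : Type*} (h : ι → V → ℝ) (S : Finset ι) :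
    ∀ (D : Set V) (φ : V → ℝ) (x₀ : V), ConvexOn ℝ D φ → IsCorePoint D x₀ →
      (∀ k ∈ S, ConvexOn ℝ D (h k) ∧ h k x₀ ≤ 0 ∧ (h k x₀ < 0 ∨ IsAffineOn D (h k))) →
      (∀ x ∈ D, (∀ k ∈ S, h k x ≤ 0) → 0 ≤ φ x) →
      ∃ τ : ι → ℝ, (∀ k, 0 ≤ τ k) ∧ ∀ x ∈ D, 0 ≤ φ x + ∑ k ∈ S, τ k * h k x := by
  induction S using Finset.induction_on with
  | empty =>
    intro D φ x₀ hφ _ _ hnn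
    exact ⟨0, fun _ => le_rfl, fun x hx => by simpa using hnn x hx (by simp)⟩
  | insert l S hl ih =>
    intro D φ x₀ hφ hx₀ hh hnn
    have hlS := hh l (Finset.mem_insert_self _ _)
    have hhS := fun k (hk : k ∈ S) => hh k (Finset.mem_insert_of_mem hk)
    have extend : ∀ (τ : ι → ℝ) (t : ℝ) (x : V),
        ∑ k ∈ insert l S, (Function.update τ l t) k * h k x = t * h l x + ∑ k ∈ S, τ k * h k x := by
      intro τ t x
      rw [Finset.sum_insert hl, Function.update_self]
      congr 1
      refine Finset.sum_congr rfl fun k hk => ?_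
      rw [Function.update_of_ne (ne_of_mem_of_not_mem hk hl)]
    have extend_nonneg : ∀ (τ : ι → ℝ) (t : ℝ), (∀ k, 0 ≤ τ k) → 0 ≤ t →
        ∀ k, 0 ≤ Function.update τ l t k := by
      intro τ t hτ ht k
      by_cases hk : k = l
      · subst hk; simpa using ht
      · simpa [Function.update_of_ne hk] using hτ k
    by_cases hex : ∃ x₁ ∈ D, (∀ k ∈ S, h k x₁ ≤ 0) ∧ h l x₁ < 0
    · obtain ⟨x₁, hx₁, hx₁S, hx₁l⟩ := hex
      -- The midpoint stays relatively interior, keeps the strict inequalities of `x₀` and gains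
      -- strictness in constraint `l`.
      set x₂ := (1 / 2 : ℝ) • x₀ + (1 / 2 : ℝ) • x₁ with hx₂
      have hle : ∀ k, ConvexOn ℝ D (h k) → h k x₂ ≤ 1 / 2 * h k x₀ + 1 / 2 * h k x₁ := by
        intro k hk
        exact hk.2 hx₀.1 hx₁ (by norm_num) (by norm_num) (by norm_num)
      have hx₂D : IsCorePoint D x₂ :=
        hx₀.combo hφ.1 hx₁ (by norm_num) (by norm_num) (by norm_num)
      have hx₂l : h l x₂ < 0 := by
        have := hle l hlS.1
        linarith [hlS.2.1]
      have hsub : {x ∈ D | h l x ≤ 0} ⊆ D := fun x hx => hx.1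
      have hconv : Convex ℝ {x ∈ D | h l x ≤ 0} := hlS.1.convex_le 0
      obtain ⟨τ, hτ, hτ'⟩ := ih {x ∈ D | h l x ≤ 0} φ x₂ (hφ.subset hsub hconv)
        (hx₂D.sublevel hlS.1 hx₂l)
        (fun k hk => ⟨(hhS k hk).1.subset hsub hconv, by
            have := hle k (hhS k hk).1
            linarith [(hhS k hk).2.1, hx₁S k hk], by
            rcases (hhS k hk).2.2 with h1 | h1
            · left
              have := hle k (hhS k hk).1
              linarith [hx₁S k hk]
            · exact Or.inr (h1.mono hsub)⟩)
        (fun x hx hxS => hnn x hx.1 (by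
          intro k hk
          rcases Finset.mem_insert.1 hk with rfl | hk
          · exact hx.2
          · exact hxS k hk))
      obtain ⟨t, ht, ht'⟩ := exists_multiplier_of_strict
        (convexOn_add_sum hφ S hτ fun k hk => (hhS k hk).1) hlS.1 hx₂D.1 hx₂l
        (fun x hx hxl => hτ' x ⟨hx, hxl⟩)
      refine ⟨Function.update τ l t, extend_nonneg τ t hτ ht, fun x hx => ?_⟩
      rw [extend]
      linarith [ht' x hx]
    · push Not at hex
      have hl0 : h l x₀ = 0 := le_antisymm hlS.2.1 (hex x₀ hx₀.1 fun k hk => (hhS k hk).2.1)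
      have hlaff : IsAffineOn D (h l) := hlS.2.2.resolve_left (by rw [hl0]; exact lt_irrefl 0)
      -- Now `h l` is nonnegative wherever the other constraints hold, so it can serve as the
      -- objective. Complementarity at `x₀` leaves `σ k ≠ 0` only for active, hence affine,
      -- constraints; the Lagrangian is then affine, nonnegative and zero at a core point, so `h l =
      -- -∑ σ k * h k` on `D`.
      obtain ⟨σ, hσ, hσ'⟩ := ih D (h l) x₀ hlS.1 hx₀ hhS (fun x hx hxS => hex x hx hxS)
      have hterm : ∀ k ∈ S, σ k * h k x₀ ≤ 0 := fun k hk =>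
        mul_nonpos_of_nonneg_of_nonpos (hσ k) (hhS k hk).2.1
      have hsum0 : ∑ k ∈ S, σ k * h k x₀ = 0 := by
        have h1 := hσ' x₀ hx₀.1
        rw [hl0, zero_add] at h1
        exact le_antisymm (Finset.sum_nonpos hterm) h1
      have hterm0 := (Finset.sum_eq_zero_iff_of_nonpos hterm).1 hsum0
      have hzero : ∀ x ∈ D, h l x + ∑ k ∈ S, σ k * h k x = 0 := by
        intro x hx
        refine hx₀.eq_zero_of_nonneg (T := fun x => h l x + ∑ k ∈ S, σ k * h k x)
          (isAffineOn_add_sum hlaff S σ fun k hk hk0 => ?_) (by simp [hl0, hsum0]) hσ' hx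
        rcases (hhS k hk).2.2 with h1 | h1
        · exact absurd ((mul_eq_zero.1 (hterm0 k hk)).resolve_left hk0) h1.ne
        · exact h1
      have hsub : {x ∈ D | h l x = 0} ⊆ D := fun x hx => hx.1
      have hconv : Convex ℝ {x ∈ D | h l x = 0} := hlaff.convex_zero hφ.1
      obtain ⟨τ, hτ, hτ'⟩ := ih {x ∈ D | h l x = 0} φ x₀ (hφ.subset hsub hconv)
        (hx₀.zero_set hlaff hl0)
        (fun k hk => ⟨(hhS k hk).1.subset hsub hconv, (hhS k hk).2.1,
          (hhS k hk).2.2.imp_right fun h1 => h1.mono hsub⟩)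
        (fun x hx hxS => hnn x hx.1 (by
          intro k hk
          rcases Finset.mem_insert.1 hk with rfl | hk
          · exact hx.2.le
          · exact hxS k hk))
      obtain ⟨η, hη⟩ := exists_linear_le_of_nonneg_on_zero
        (convexOn_add_sum hφ S hτ fun k hk => (hhS k hk).1) hlaff hx₀ hl0
        (fun x hx hx0 => hτ' x ⟨hx, hx0⟩)
      have hη1 : ∀ r : ℝ, η r = r * η 1 := fun r => by
        rw [← smul_eq_mul, ← map_smul, smul_eq_mul, mul_one]
      -- The multiplier of the equality `h l = 0` has no sign. If `-η 1` is negative, the identity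
      -- for `h l` shifts its weight to the other constraints.
      rcases le_total (η 1) 0 with hneg | hpos
      · refine ⟨Function.update τ l (-η 1), extend_nonneg τ _ hτ (by linarith), fun x hx => ?_⟩
        rw [extend]
        have h1 := hη x hx
        rw [hη1] at h1
        linarith
      · refine ⟨Function.update (fun k => τ k + η 1 * σ k) l 0,
          extend_nonneg _ 0 (fun k => add_nonneg (hτ k) (mul_nonneg hpos (hσ k))) le_rfl,
          fun x hx => ?_⟩
        rw [extend]
        have h1 := hη x hx
        rw [hη1] at h1
        have h2 : ∑ k ∈ S, (τ k + η 1 * σ k) * h k x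
            = ∑ k ∈ S, τ k * h k x + η 1 * ∑ k ∈ S, σ k * h k x := by
          rw [Finset.mul_sum, ← Finset.sum_add_distrib]
          exact Finset.sum_congr rfl fun k _ => by ring
        rw [h2]
        have h3 := hzero x hx
        have h4 : ∑ k ∈ S, σ k * h k x = -h l x := by linarith
        rw [h4]
        linarith

end Multipliers

/-! ### Relative interiors, and suprema over independent variables. -/

/-- A point of the intrinsic interior lies in the relative algebraic interior. -/
theorem isCorePoint_of_mem_intrinsicInterior {E : Type*} [NormedAddCommGroup E] [NormedSpace ℝ E]
    {D : Set E} {x₀ : E} (h : x₀ ∈ intrinsicInterior ℝ D) : IsCorePoint D x₀ := by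
  refine ⟨intrinsicInterior_subset h, fun x hx => ?_⟩
  obtain ⟨y, hy, rfl⟩ := mem_intrinsicInterior.1 h
  have hxA : x ∈ affineSpan ℝ D := subset_affineSpan ℝ D hx
  let γ : ℝ → affineSpan ℝ D := fun r =>
    ⟨AffineMap.lineMap (y : E) x (-r), AffineMap.lineMap_mem _ y.2 hxA⟩
  have hγ : Continuous γ := by
    refine Continuous.subtype_mk ?_ _
    exact AffineMap.lineMap_continuous.comp continuous_neg
  have hγ0 : γ 0 = y := by ext; simp [γ]
  have hev : ∀ᶠ r in nhds (0 : ℝ), γ r ∈ interior ((↑) ⁻¹' D : Set (affineSpan ℝ D)) :=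
    hγ.continuousAt.eventually (by rw [hγ0]; exact isOpen_interior.mem_nhds hy)
  obtain ⟨δ, hδ, hball⟩ := Metric.eventually_nhds_iff.1 hev
  refine ⟨δ / 2, by positivity, ?_⟩
  have h1 := interior_subset (hball (y := δ / 2) (by
    rw [Real.dist_eq, sub_zero, abs_of_pos (by positivity)]; linarith))
  have h2 : ((γ (δ / 2) : affineSpan ℝ D) : E) ∈ D := h1
  convert h2 using 1
  simp only [γ, AffineMap.lineMap_apply_module]
  module

/-- A supremum of a sum over independent variables splits into a sum of suprema. -/
theorem exists_bounds_of_sum_le {ι : Type*} [Fintype ι] {X : ι → Type*} (S : ∀ k, Set (X k))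
    (F : ∀ k, X k → ℝ) (hS : ∀ k, (S k).Nonempty) (M : ℝ)
    (h : ∀ u : ∀ k, X k, (∀ k, u k ∈ S k) → ∑ k, F k (u k) ≤ M) :
    ∃ r : ι → ℝ, (∀ k, ∀ x ∈ S k, F k x ≤ r k) ∧ ∑ k, r k ≤ M := by
  classical
  choose v hv using hS
  have hb : ∀ k, BddAbove (F k '' S k) := by
    intro k
    refine ⟨M - ∑ l ∈ Finset.univ.erase k, F l (v l), ?_⟩
    rintro _ ⟨x, hx, rfl⟩
    have h1 := h (Function.update v k x) (fun l => by
      by_cases hl : l = k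
      · subst hl; simpa using hx
      · simpa [Function.update_of_ne hl] using hv l)
    rw [← Finset.add_sum_erase _ _ (Finset.mem_univ k), Function.update_self] at h1
    have h2 : ∑ l ∈ Finset.univ.erase k, F l (Function.update v k x l)
        = ∑ l ∈ Finset.univ.erase k, F l (v l) :=
      Finset.sum_congr rfl fun l hl => by rw [Function.update_of_ne (Finset.ne_of_mem_erase hl)]
    rw [h2] at h1
    linarith
  refine ⟨fun k => sSup (F k '' S k), fun k x hx => le_csSup (hb k) ⟨x, hx, rfl⟩, ?_⟩
  refine le_of_forall_pos_le_add fun δ hδ => ?_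
  -- Near-maximizers in every coordinate with total error at most `δ`; the `+ 1` covers an empty
  -- index type.
  have hδ' : 0 < δ / (Fintype.card ι + 1 : ℝ) := by positivity
  have hnear : ∀ k, ∃ x ∈ S k, sSup (F k '' S k) - δ / (Fintype.card ι + 1 : ℝ) < F k x := by
    intro k
    obtain ⟨_, ⟨x, hx, rfl⟩, hlt⟩ :=
      exists_lt_of_lt_csSup (Set.Nonempty.image _ ⟨v k, hv k⟩) (sub_lt_self (sSup (F k '' S k)) hδ')
    exact ⟨x, hx, hlt⟩
  choose u hu hlt using hnear
  have h1 := h u hu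
  have h2 : ∑ k, (sSup (F k '' S k) - δ / (Fintype.card ι + 1 : ℝ)) ≤ ∑ k, F k (u k) :=
    Finset.sum_le_sum fun k _ => (hlt k).le
  rw [Finset.sum_sub_distrib, Finset.sum_const, Finset.card_univ, nsmul_eq_mul] at h2
  have h3 : (Fintype.card ι : ℝ) * (δ / (Fintype.card ι + 1 : ℝ)) ≤ δ := by
    rw [mul_div_assoc', div_le_iff₀ (by positivity)]
    nlinarith
  linarith

/-! ### Extended real numbers -/

theorem EReal.exists_coe_of_add_le {a b : EReal} (ha : ⊥ < a) (hb : ⊥ < b) {r : ℝ}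
    (h : a + b ≤ (r : EReal)) : ∃ r₁ r₂ : ℝ, a ≤ r₁ ∧ b ≤ r₂ ∧ r₁ + r₂ = r := by
  induction a with
  | bot => exact absurd ha (lt_irrefl _)
  | top => rw [EReal.top_add_of_ne_bot hb.ne'] at h; exact absurd h (by simp)
  | coe a =>
    induction b with
    | bot => exact absurd hb (lt_irrefl _)
    | top => rw [EReal.add_top_of_ne_bot ha.ne'] at h; exact absurd h (by simp)
    | coe b =>
      rw [← EReal.coe_add, EReal.coe_le_coe_iff] at h
      exact ⟨a, r - a, le_rfl, EReal.coe_le_coe_iff.2 (by linarith), by ring⟩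

theorem EReal.bot_lt_sum {ι : Type*} (s : Finset ι) {a : ι → EReal} (ha : ∀ i ∈ s, ⊥ < a i) :
    ⊥ < ∑ i ∈ s, a i := by
  classical
  induction s using Finset.induction_on with
  | empty => simp
  | insert i s hi ih =>
    rw [Finset.sum_insert hi, EReal.bot_lt_add_iff]
    exact ⟨ha i (Finset.mem_insert_self _ _), ih fun j hj => ha j (Finset.mem_insert_of_mem hj)⟩

theorem EReal.coe_finset_sum {ι : Type*} (s : Finset ι) (a : ι → ℝ) :
    ((∑ i ∈ s, a i : ℝ) : EReal) = ∑ i ∈ s, (a i : EReal) := by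
  classical
  induction s using Finset.induction_on with
  | empty => simp
  | insert i s hi ih => rw [Finset.sum_insert hi, Finset.sum_insert hi, EReal.coe_add, ih]

/-- A real number below all real upper bounds of an extended real number is below that number. -/
theorem EReal.coe_le_of_forall_le {a : EReal} {v : ℝ} (h : ∀ r : ℝ, a ≤ (r : EReal) → v ≤ r) :
    (v : EReal) ≤ a := by
  induction a with
  | bot => exact absurd (h (v - 1) bot_le) (by linarith)
  | top => exact le_top
  | coe a => exact EReal.coe_le_coe_iff.2 (h a le_rfl)

/-! ### Convex extended-real-valued functions -/

theorem coe_toReal_of_mem_effDom {X : Type*} {F : X → EReal} (hF0 : ∀ x, ⊥ < F x) {x : X}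
    (hx : x ∈ effDom F) : ((F x).toReal : EReal) = F x :=
  EReal.coe_toReal hx.ne (hF0 x).ne'

section ConvexFn

variable {X : Type*} [AddCommGroup X] [Module ℝ X] {S : Set X}

/-- A supremum of convex functions is convex. Stating it through real upper bounds avoids arithmetic
with infinite values. -/
theorem isConvexFnOn_of_le_iff (hS : Convex ℝ S) {F : X → EReal} {ι : Type*} (P : Set ι)
    (a : ι → X → ℝ) (ha : ∀ i ∈ P, ConvexOn ℝ S (a i))
    (hF : ∀ x ∈ S, ∀ r : ℝ, F x ≤ (r : EReal) ↔ ∀ i ∈ P, a i x ≤ r) : IsConvexFnOn S F := by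
  rintro ⟨x, r⟩ ⟨hx, hxr⟩ ⟨y, s⟩ ⟨hy, hys⟩ t u ht hu htu
  simp only at hx hxr hy hys
  have hxy := hS hx hy ht hu htu
  refine ⟨hxy, (hF _ hxy _).2 fun i hi => ?_⟩
  refine ((ha i hi).2 hx hy ht hu htu).trans ?_
  exact add_le_add (mul_le_mul_of_nonneg_left ((hF x hx r).1 hxr i hi) ht)
    (mul_le_mul_of_nonneg_left ((hF y hy s).1 hys i hi) hu)

/-- Excluding `⊥` is essential: since `⊥ + ⊤ = ⊥`, a real bound on the sum would otherwise not split
into bounds on the summands. -/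
theorem IsConvexFnOn.add {F H : X → EReal} (hF : IsConvexFnOn S F) (hH : IsConvexFnOn S H)
    (hF0 : ∀ x ∈ S, ⊥ < F x) (hH0 : ∀ x ∈ S, ⊥ < H x) : IsConvexFnOn S (fun x => F x + H x) := by
  rintro ⟨x, r⟩ ⟨hx, hxr⟩ ⟨y, s⟩ ⟨hy, hys⟩ t u ht hu htu
  simp only at hx hxr hy hys
  obtain ⟨r₁, r₂, h1, h2, rfl⟩ := EReal.exists_coe_of_add_le (hF0 x hx) (hH0 x hx) hxr
  obtain ⟨s₁, s₂, h3, h4, rfl⟩ := EReal.exists_coe_of_add_le (hF0 y hy) (hH0 y hy) hys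
  have h5 := hF (x := (x, r₁)) ⟨hx, h1⟩ (y := (y, s₁)) ⟨hy, h3⟩ ht hu htu
  have h6 := hH (x := (x, r₂)) ⟨hx, h2⟩ (y := (y, s₂)) ⟨hy, h4⟩ ht hu htu
  refine ⟨h5.1, (add_le_add h5.2 h6.2).trans_eq ?_⟩
  simp only [Prod.smul_mk, Prod.mk_add_mk, smul_eq_mul]
  rw [← EReal.coe_add]
  congr 1
  ring

theorem IsConvexFnOn.sum (hS : Convex ℝ S) {ι : Type*} (s : Finset ι) {F : ι → X → EReal}
    (hF : ∀ i ∈ s, IsConvexFnOn S (F i)) (hF0 : ∀ i ∈ s, ∀ x ∈ S, ⊥ < F i x) :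
    IsConvexFnOn S (fun x => ∑ i ∈ s, F i x) := by
  classical
  induction s using Finset.induction_on with
  | empty =>
    refine isConvexFnOn_of_le_iff hS Set.univ (fun (_ : Unit) _ => 0)
      (fun _ _ => convexOn_const 0 hS) fun x _ r => ?_
    simp
  | insert i s hi ih =>
    simp only [Finset.sum_insert hi]
    refine (hF i (Finset.mem_insert_self _ _)).add
      (ih (fun j hj => hF j (Finset.mem_insert_of_mem hj))
        fun j hj => hF0 j (Finset.mem_insert_of_mem hj))
      (hF0 i (Finset.mem_insert_self _ _)) fun x hx => ?_
    exact EReal.bot_lt_sum s fun j hj => hF0 j (Finset.mem_insert_of_mem hj) x hx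

theorem IsConvexFn.convex_sublevel {F : X → EReal} (hF : IsConvexFn F) (r : ℝ) :
    Convex ℝ {x | F x ≤ (r : EReal)} := by
  intro x hx y hy t u ht hu htu
  have h := hF (x := (x, r)) ⟨trivial, hx⟩ (y := (y, r)) ⟨trivial, hy⟩ ht hu htu
  have h2 := h.2
  simp only [Prod.smul_mk, Prod.mk_add_mk, smul_eq_mul] at h2
  rwa [← add_mul, htu, one_mul] at h2

theorem IsConvexFn.convexOn_toReal {F : X → EReal} (hF : IsConvexFn F) (hF0 : ∀ x, ⊥ < F x) :
    ConvexOn ℝ (effDom F) fun x => (F x).toReal := by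
  have key : ∀ x ∈ effDom F, ∀ y ∈ effDom F, ∀ t u : ℝ, 0 ≤ t → 0 ≤ u → t + u = 1 →
      F (t • x + u • y) ≤ ((t * (F x).toReal + u * (F y).toReal : ℝ) : EReal) := by
    intro x hx y hy t u ht hu htu
    exact (hF (x := (x, (F x).toReal)) ⟨trivial, (coe_toReal_of_mem_effDom hF0 hx).ge⟩
      (y := (y, (F y).toReal)) ⟨trivial, (coe_toReal_of_mem_effDom hF0 hy).ge⟩ ht hu htu).2
  have hconv : Convex ℝ (effDom F) := fun x hx y hy t u ht hu htu =>
    (key x hx y hy t u ht hu htu).trans_lt (EReal.coe_lt_top _)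
  refine ⟨hconv, fun x hx y hy t u ht hu htu => ?_⟩
  have h := key x hx y hy t u ht hu htu
  rw [← coe_toReal_of_mem_effDom hF0 (hconv hx hy ht hu htu), EReal.coe_le_coe_iff] at h
  exact h

end ConvexFn

/-! ### Conjugates and perspectives -/

section Conjugate

variable {E : Type*} [NormedAddCommGroup E] [InnerProductSpace ℝ E] {h : E → EReal}

theorem conj_le_iff (h0 : ∀ x, ⊥ < h x) (y : E) (r : ℝ) :
    conj h y ≤ (r : EReal) ↔ ∀ z ∈ effDom h, inner ℝ y z - (h z).toReal ≤ r := by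
  rw [conj, iSup_le_iff]
  refine forall_congr' fun z => ?_
  by_cases hz : z ∈ effDom h
  · rw [← coe_toReal_of_mem_effDom h0 hz, ← EReal.coe_sub, EReal.coe_le_coe_iff, EReal.toReal_coe]
    simp [hz]
  · have : h z = ⊤ := not_lt_top_iff.1 hz
    simp [hz, this]

theorem coe_sub_le_conj (y z : E) : ((inner ℝ y z : ℝ) : EReal) - h z ≤ conj h y :=
  le_iSup (fun z => ((inner ℝ y z : ℝ) : EReal) - h z) z

theorem bot_lt_conj (h0 : ∀ x, ⊥ < h x) (hne : (effDom h).Nonempty) (y : E) : ⊥ < conj h y := by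
  obtain ⟨z, hz⟩ := hne
  refine lt_of_lt_of_le ?_ (coe_sub_le_conj y z)
  rw [← coe_toReal_of_mem_effDom h0 hz, ← EReal.coe_sub]
  exact EReal.bot_lt_coe _

theorem effDom_subset_effDom_conj_conj (h0 : ∀ x, ⊥ < h x) :
    effDom h ⊆ effDom (conj (conj h)) := by
  intro z hz
  refine lt_of_le_of_lt (b := h z) (iSup_le fun y => ?_) hz
  have h1 := coe_sub_le_conj (h := h) y z
  rw [← coe_toReal_of_mem_effDom h0 hz, ← EReal.coe_sub] at h1
  rw [← coe_toReal_of_mem_effDom h0 hz, real_inner_comm]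
  refine (EReal.sub_le_sub le_rfl h1).trans ?_
  rw [← EReal.coe_sub, EReal.coe_le_coe_iff]
  linarith

variable [FiniteDimensional ℝ E]

/-- A convex function has an affine minorant, exact at a relative interior point of the domain. -/
theorem exists_affine_minorant (h0 : ∀ x, ⊥ < h x) (hconv : IsConvexFn h) {x₀ : E}
    (hx₀ : IsCorePoint (effDom h) x₀) :
    ∃ (y : E) (β : ℝ), ∀ z ∈ effDom h, inner ℝ y z - (h z).toReal ≤ β := by
  have hφ : ConvexOn ℝ (effDom h) fun z => (h z).toReal - (h x₀).toReal :=
    (hconv.convexOn_toReal h0).sub (concaveOn_const _ (hconv.convexOn_toReal h0).1)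
  -- With this `T` the only constraint is `z = x₀`, and the multiplier is a subgradient at `x₀`.
  obtain ⟨η, hη⟩ := exists_linear_le_of_nonneg_on_zero hφ (T := fun z => z - x₀)
    (fun x _ y _ a b _ _ hab => by
      have : x₀ = (a + b) • x₀ := by rw [hab, one_smul]
      nth_rewrite 1 [this]
      module) hx₀ (sub_self x₀)
    (fun z _ hz => by rw [sub_eq_zero.1 hz, sub_self])
  let y := (InnerProductSpace.toDual ℝ E).symm (LinearMap.toContinuousLinearMap η)
  have hy : ∀ z, inner ℝ y z = η z := fun z => by simp [y]
  refine ⟨y, η x₀ - (h x₀).toReal, fun z hz => ?_⟩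
  have h1 := hη z hz
  rw [map_sub] at h1
  rw [hy]
  linarith

/-- The perspective of a conjugate, including its value at `t = 0`, is a supremum of linear
functions over the domain of the original function. -/
theorem perspective_conj_le_iff (h0 : ∀ x, ⊥ < h x) (hconv : IsConvexFn h) {x₀ : E}
    (hx₀ : IsCorePoint (effDom h) x₀) {t : ℝ} (ht : 0 ≤ t) (x : E) (r : ℝ) :
    perspective (conj h) x t ≤ (r : EReal) ↔
      ∀ z ∈ effDom h, inner ℝ x z - t * (h z).toReal ≤ r := by
  rcases ht.lt_or_eq with ht | rfl
  · rw [perspective, if_pos ht, mul_comm,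
      ← EReal.le_div_iff_mul_le (EReal.coe_pos.2 ht) (EReal.coe_ne_top _), ← EReal.coe_div,
      conj_le_iff h0]
    refine forall₂_congr fun z _ => ?_
    rw [inner_smul_left, le_div_iff₀ ht]
    have : ((starRingEnd ℝ) t⁻¹ * inner ℝ x z - (h z).toReal) * t
        = inner ℝ x z - t * (h z).toReal := by
      simp only [conj_trivial]
      field_simp
    rw [this]
  · rw [perspective, if_neg (lt_irrefl _)]
    have hind : conj (indicatorFn (effDom (conj (conj h)))) x ≤ (r : EReal) ↔
        ∀ z ∈ effDom (conj (conj h)), inner ℝ x z ≤ r := by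
      rw [conj, iSup_le_iff]
      refine forall_congr' fun z => ?_
      by_cases hz : z ∈ effDom (conj (conj h)) <;> simp [indicatorFn, hz]
    rw [hind]
    simp only [zero_mul, sub_zero]
    refine ⟨fun H z hz => H z (effDom_subset_effDom_conj_conj h0 hz), fun H z hz => ?_⟩
    obtain ⟨y, β, hy⟩ := exists_affine_minorant h0 hconv hx₀
    -- As `⟨x, ·⟩ ≤ r` on the domain, tilting the minorant by `s • x` raises the conjugate bound by
    -- at most `s * r`. If `⟨x, z⟩ > r`, the biconjugate at `z` would thus exceed every real number.
    have hlow : ∀ s : ℝ, 0 ≤ s →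
        ((inner ℝ y z + s * inner ℝ x z - (β + s * r) : ℝ) : EReal) ≤ conj (conj h) z := by
      intro s hs
      have h1 : conj h (y + s • x) ≤ ((β + s * r : ℝ) : EReal) := by
        rw [conj_le_iff h0]
        intro w hw
        rw [inner_add_left, inner_smul_left, conj_trivial]
        have h2 := hy w hw
        have h3 := mul_le_mul_of_nonneg_left (H w hw) hs
        linarith
      refine le_trans ?_ (coe_sub_le_conj (h := conj h) z (y + s • x))
      refine le_trans ?_ (EReal.sub_le_sub le_rfl h1)
      rw [← EReal.coe_sub, EReal.coe_le_coe_iff, inner_add_right, inner_smul_right,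
        real_inner_comm y z, real_inner_comm x z]
    by_contra hlt
    push Not at hlt
    set N := (conj (conj h) z).toReal with hN
    have hcoe : (N : EReal) = conj (conj h) z :=
      EReal.coe_toReal hz.ne (lt_of_lt_of_le (EReal.bot_lt_coe _) (hlow 0 le_rfl)).ne'
    have hd : 0 < inner ℝ x z - r := by linarith
    -- This `s` pushes the lower bound to at least `N + 1`.
    have h2 := hlow ((|N - inner ℝ y z + β| + 1) / (inner ℝ x z - r)) (by positivity)
    rw [← hcoe, EReal.coe_le_coe_iff] at h2
    have h3 : (|N - inner ℝ y z + β| + 1) / (inner ℝ x z - r) * (inner ℝ x z - r)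
        = |N - inner ℝ y z + β| + 1 := div_mul_cancel₀ _ hd.ne'
    have h4 := le_abs_self (N - inner ℝ y z + β)
    linarith

theorem le_perspective_conj (h0 : ∀ x, ⊥ < h x) (hconv : IsConvexFn h) {x₀ : E}
    (hx₀ : IsCorePoint (effDom h) x₀) {t : ℝ} (ht : 0 ≤ t) (x : E) {z : E} (hz : z ∈ effDom h) :
    ((inner ℝ x z - t * (h z).toReal : ℝ) : EReal) ≤ perspective (conj h) x t :=
  EReal.coe_le_of_forall_le fun r hr =>
    (perspective_conj_le_iff h0 hconv hx₀ ht x r).1 hr z hz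

theorem bot_lt_perspective_conj (h0 : ∀ x, ⊥ < h x) (hconv : IsConvexFn h) {x₀ : E}
    (hx₀ : IsCorePoint (effDom h) x₀) {t : ℝ} (ht : 0 ≤ t) (x : E) :
    ⊥ < perspective (conj h) x t :=
  (EReal.bot_lt_coe _).trans_le (le_perspective_conj h0 hconv hx₀ ht x hx₀.1)

end Conjugate

/-! ### Convexity of the finite program -/

section Program

variable {m d I J K : ℕ} {Θ : Set (EuclideanSpace ℝ (Fin m))}
  {ℓs : Fin I → EuclideanSpace ℝ (Fin m) → EuclideanSpace ℝ (Fin d) → ℝ}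
  {c : EuclideanSpace ℝ (Fin d) → EuclideanSpace ℝ (Fin d) → ℝ≥0∞}
  {f : Fin K → EuclideanSpace ℝ (Fin d) → EReal} {zhat : Fin J → EuclideanSpace ℝ (Fin d)}

theorem convex_primalGround (hΘ : Convex ℝ Θ) :
    Convex ℝ (primalGround Θ : Set (PrimalVar m d I J K)) := by
  rintro x ⟨hx1, hx2, hx3⟩ y ⟨hy1, hy2, hy3⟩ a b ha hb hab
  exact ⟨hΘ hx1 hy1 ha hb hab, add_nonneg (mul_nonneg ha hx2) (mul_nonneg hb hy2),
    fun i j k => add_nonneg (mul_nonneg ha (hx3 i j k)) (mul_nonneg hb (hy3 i j k))⟩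

theorem coe_ennreal_bot_lt (a : ℝ≥0∞) : (⊥ : EReal) < (a : EReal) :=
  lt_of_lt_of_le EReal.bot_lt_zero (EReal.coe_ennreal_nonneg a)

theorem bot_lt_conj_coe {E : Type*} [NormedAddCommGroup E] [InnerProductSpace ℝ E] (g : E → ℝ)
    (y : E) : ⊥ < conj (fun z => (g z : EReal)) y :=
  bot_lt_conj (fun _ => EReal.bot_lt_coe _) ⟨0, EReal.coe_lt_top _⟩ y

theorem conj_coe_le_iff {E : Type*} [NormedAddCommGroup E] [InnerProductSpace ℝ E] (g : E → ℝ)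
    (y : E) (r : ℝ) : conj (fun z => (g z : EReal)) y ≤ (r : EReal) ↔
      ∀ z, inner ℝ y z - g z ≤ r := by
  rw [conj_le_iff (fun _ => EReal.bot_lt_coe _)]
  simp [effDom]

theorem isConvexFnOn_perspective_comp {X E : Type*} [AddCommGroup X] [Module ℝ X]
    [NormedAddCommGroup E] [InnerProductSpace ℝ E] [FiniteDimensional ℝ E] {S : Set X}
    (hS : Convex ℝ S) {h : E → EReal} (h0 : ∀ x, ⊥ < h x) (hconv : IsConvexFn h) {x₀ : E}
    (hx₀ : IsCorePoint (effDom h) x₀) (A : X →ₗ[ℝ] E) (t : X →ₗ[ℝ] ℝ) (ht : ∀ x ∈ S, 0 ≤ t x) :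
    IsConvexFnOn S (fun x => perspective (conj h) (A x) (t x)) := by
  refine isConvexFnOn_of_le_iff hS (effDom h) (fun z x => inner ℝ (A x) z - t x * (h z).toReal)
    (fun z _ => ⟨hS, fun x _ y _ a b _ _ _ => le_of_eq ?_⟩)
    fun x hx r => perspective_conj_le_iff h0 hconv hx₀ (ht x hx) (A x) r
  simp only [map_add, map_smul, inner_add_left, inner_smul_left, conj_trivial, smul_eq_mul]
  ring

/-- The conjugate term is the supremum over z of ⟨ζ,z⟩ + ℓ_i(θ,z), each jointly convex in (θ,ζ). The
base point `zhat j` keeps all perspectives above `⊥`, so the sum is convex. -/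
theorem isConvexFnOn_primalLHS (hΘ : Convex ℝ Θ)
    (hℓ : ∀ i z, ConvexOn ℝ Θ (fun θ => ℓs i θ z))
    (hc : ∀ j, IsConvexFn fun z => (c z (zhat j) : EReal))
    (hc' : ∀ j, IsCorePoint (effDom fun z => (c z (zhat j) : EReal)) (zhat j))
    (hf0 : ∀ k x, ⊥ < f k x) (hf : ∀ k, IsConvexFn (f k))
    (hf' : ∀ k j, IsCorePoint (effDom (f k)) (zhat j)) (i : Fin I) (j : Fin J) :
    IsConvexFnOn (primalGround Θ) (primalLHS ℓs c f zhat i j) := by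
  have hS : Convex ℝ (primalGround Θ : Set (PrimalVar m d I J K)) := convex_primalGround hΘ
  have hc0 : ∀ z, (⊥ : EReal) < (c z (zhat j) : EReal) := fun z => coe_ennreal_bot_lt _
  have h1 : IsConvexFnOn (primalGround Θ) fun x : PrimalVar m d I J K =>
      conj (fun z => ((-ℓs i x.theta z : ℝ) : EReal)) (x.zetaL i j) := by
    refine isConvexFnOn_of_le_iff hS Set.univ
      (fun z x => inner ℝ (x.zetaL i j) z + ℓs i x.theta z)
      (fun z _ => ⟨hS, fun x hx y hy a b ha hb hab => ?_⟩) fun x _ r => ?_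
    · have h2 := (hℓ i z).2 hx.1 hy.1 ha hb hab
      have h3 : (a • x + b • y).zetaL i j = a • x.zetaL i j + b • y.zetaL i j := rfl
      have h4 : (a • x + b • y).theta = a • x.theta + b • y.theta := rfl
      simp only [smul_eq_mul] at h2
      simp only [h3, h4, inner_add_left, inner_smul_left, conj_trivial, smul_eq_mul]
      linarith
    · rw [conj_coe_le_iff]
      simp
  have h2 : IsConvexFnOn (primalGround Θ) fun x : PrimalVar m d I J K =>
      perspective (conj fun z => (c z (zhat j) : EReal)) (x.zetaC i j) x.lam :=
    isConvexFnOn_perspective_comp hS hc0 (hc j) (hc' j)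
      { toFun := fun x => x.zetaC i j, map_add' := fun _ _ => rfl, map_smul' := fun _ _ => rfl }
      { toFun := fun x => x.lam, map_add' := fun _ _ => rfl, map_smul' := fun _ _ => rfl }
      fun x hx => hx.2.1
  have h3 : ∀ k, IsConvexFnOn (primalGround Θ) fun x : PrimalVar m d I J K =>
      perspective (conj (f k)) (x.zetaF i j k) (x.tau i j k) := fun k =>
    isConvexFnOn_perspective_comp hS (hf0 k) (hf k) (hf' k j)
      { toFun := fun x => x.zetaF i j k, map_add' := fun _ _ => rfl, map_smul' := fun _ _ => rfl }
      { toFun := fun x => x.tau i j k, map_add' := fun _ _ => rfl, map_smul' := fun _ _ => rfl }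
      fun x hx => hx.2.2 i j k
  have b2 := fun (x : PrimalVar m d I J K) (hx : x ∈ primalGround Θ) =>
    bot_lt_perspective_conj hc0 (hc j) (hc' j) hx.2.1 (x.zetaC i j)
  have b3 := fun k (x : PrimalVar m d I J K) (hx : x ∈ primalGround Θ) =>
    bot_lt_perspective_conj (hf0 k) (hf k) (hf' k j) (hx.2.2 i j k) (x.zetaF i j k)
  refine (h1.add h2 (fun x _ => bot_lt_conj_coe _ _) b2).add
    (IsConvexFnOn.sum hS Finset.univ (fun k _ => h3 k) fun k _ => b3 k)
    (fun x hx => EReal.bot_lt_add_iff.2 ⟨bot_lt_conj_coe _ _, b2 x hx⟩)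
    fun x hx => EReal.bot_lt_sum _ fun k _ => b3 k x hx

theorem convex_primalFeasible (hΘ : Convex ℝ Θ)
    (hLHS : ∀ i j, IsConvexFnOn (primalGround Θ) (primalLHS ℓs c f zhat i j)) :
    Convex ℝ (primalFeasible Θ ℓs c f zhat) := by
  intro x hx y hy a b ha hb hab
  refine ⟨convex_primalGround hΘ hx.1 hy.1 ha hb hab, fun i j => ?_, fun i j => ?_⟩
  · exact (hLHS i j (x := (x, x.s j)) ⟨hx.1, hx.2.1 i j⟩ (y := (y, y.s j)) ⟨hy.1, hy.2.1 i j⟩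
      ha hb hab).2
  · have h1 := hx.2.2 i j
    have h2 := hy.2.2 i j
    have h3 : (a • x + b • y).zetaL i j + (a • x + b • y).zetaC i j
        + ∑ k, (a • x + b • y).zetaF i j k
        = a • (x.zetaL i j + x.zetaC i j + ∑ k, x.zetaF i j k)
          + b • (y.zetaL i j + y.zetaC i j + ∑ k, y.zetaF i j k) := by
      have h4 : ∀ k, (a • x + b • y).zetaF i j k = a • x.zetaF i j k + b • y.zetaF i j k :=
        fun _ => rfl
      have h5 : (a • x + b • y).zetaL i j = a • x.zetaL i j + b • y.zetaL i j := rfl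
      have h6 : (a • x + b • y).zetaC i j = a • x.zetaC i j + b • y.zetaC i j := rfl
      simp only [h4, h5, h6, Finset.sum_add_distrib, ← Finset.smul_sum]
      module
    rw [h3, h1, h2, smul_zero, smul_zero, add_zero]

theorem convexOn_primalObjective (ε : ℝ) (p : Fin J → ℝ) :
    ConvexOn ℝ Set.univ (primalObjective ε p : PrimalVar m d I J K → ℝ) := by
  refine ⟨convex_univ, fun x _ y _ a b _ _ _ => le_of_eq ?_⟩
  have h1 : (a • x + b • y).lam = a * x.lam + b * y.lam := rfl
  have h2 : ∀ j, (a • x + b • y).s j = a * x.s j + b * y.s j := fun _ => rfl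
  simp only [primalObjective, h1, h2, smul_eq_mul, mul_add, Finset.mul_sum,
    Finset.sum_add_distrib, add_mul]
  have h3 : ∀ j, p j * (a * x.s j) = a * (p j * x.s j) := fun _ => by ring
  have h4 : ∀ j, p j * (b * y.s j) = b * (p j * y.s j) := fun _ => by ring
  simp only [h3, h4]
  ring

end Program

/-! ### Duality for the inner maximization over `z` -/

/-- Having all short prolongations in `D` allows one common length for finitely many domains. -/
theorem IsCorePoint.eventually {V : Type*} [AddCommGroup V] [Module ℝ V] {D : Set V}
    (hD : Convex ℝ D) {x₀ : V} (hx₀ : IsCorePoint D x₀) {x : V} (hx : x ∈ D) :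
    ∀ᶠ r in nhdsWithin (0 : ℝ) (Set.Ioi 0), x₀ + r • (x₀ - x) ∈ D := by
  obtain ⟨s, hs, hy⟩ := hx₀.2 x hx
  filter_upwards [Ioc_mem_nhdsGT hs] with r hr
  have h1 := hD.prolong_mem hx₀.1 (s := r / s) (div_nonneg hr.1.le hs.le)
    ((div_le_one hs).2 hr.2) hy
  rwa [div_mul_cancel₀ _ hs.ne'] at h1

section InnerDuality

variable {E : Type*} [NormedAddCommGroup E] [InnerProductSpace ℝ E] [FiniteDimensional ℝ E]
  {ℓ : E → ℝ} {c : E → EReal} {x₀ : E} {K : ℕ} {f : Fin K → E → EReal}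

/-- Every feasible dual point bounds the penalized objective. -/
theorem sub_mul_le_of_conj_add_perspective_le (hc0 : ∀ x, ⊥ < c x) (hc : IsConvexFn c)
    (hcx : IsCorePoint (effDom c) x₀) (hf0 : ∀ k x, ⊥ < f k x) (hf : ∀ k, IsConvexFn (f k))
    (hfx : ∀ k, IsCorePoint (effDom (f k)) x₀) {lam : ℝ} (hlam : 0 ≤ lam) {τ : Fin K → ℝ}
    (hτ : ∀ k, 0 ≤ τ k) {ζL ζC : E} {ζF : Fin K → E} (hζ : ζL + ζC + ∑ k, ζF k = 0) {M : ℝ}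
    (hM : conj (fun z => ((-ℓ z : ℝ) : EReal)) ζL + perspective (conj c) ζC lam
      + ∑ k, perspective (conj (f k)) (ζF k) (τ k) ≤ (M : EReal))
    {z : E} (hz : z ∈ effDom c) (hfz : ∀ k, f k z ≤ 0) : ℓ z - lam * (c z).toReal ≤ M := by
  have h1 : ((inner ℝ ζL z + ℓ z : ℝ) : EReal) ≤ conj (fun z => ((-ℓ z : ℝ) : EReal)) ζL := by
    refine le_trans (le_of_eq ?_) (coe_sub_le_conj ζL z)
    rw [← EReal.coe_sub, sub_neg_eq_add]
  have h2 := le_perspective_conj hc0 hc hcx hlam ζC hz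
  have h3 : ∀ k, ((inner ℝ (ζF k) z : ℝ) : EReal) ≤ perspective (conj (f k)) (ζF k) (τ k) := by
    intro k
    have hzk : z ∈ effDom (f k) := (hfz k).trans_lt (EReal.coe_lt_top 0)
    refine le_trans ?_ (le_perspective_conj (hf0 k) (hf k) (hfx k) (hτ k) (ζF k) hzk)
    rw [EReal.coe_le_coe_iff]
    have h4 : (f k z).toReal ≤ 0 := by
      have h5 := hfz k
      rw [← coe_toReal_of_mem_effDom (hf0 k) hzk] at h5
      exact_mod_cast h5
    nlinarith [hτ k]
  have h4 := (add_le_add (add_le_add h1 h2) (Finset.sum_le_sum fun k _ => h3 k)).trans hM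
  rw [← EReal.coe_finset_sum, ← EReal.coe_add, ← EReal.coe_add, EReal.coe_le_coe_iff,
    ← sum_inner] at h4
  have h5 : inner ℝ ζL z + inner ℝ ζC z + inner ℝ (∑ k, ζF k) z = 0 := by
    rw [← inner_add_left, ← inner_add_left, hζ, inner_zero_left]
  linarith

/-- Strong duality with dual attainment for the penalized maximization problem. -/
theorem exists_conj_add_perspective_le (hℓ : ConcaveOn ℝ Set.univ ℓ)
    (hc0 : ∀ x, ⊥ < c x) (hc : IsConvexFn c)
    (hcx : IsCorePoint (effDom c) x₀) (hf0 : ∀ k x, ⊥ < f k x) (hf : ∀ k, IsConvexFn (f k))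
    (hfx : ∀ k, IsCorePoint (effDom (f k)) x₀) (hfx0 : ∀ k, f k x₀ ≤ 0)
    (hstrict : ∀ k, ¬ IsAffineFn (f k) → f k x₀ < 0) {lam : ℝ} (hlam : 0 ≤ lam) {M : ℝ}
    (hM : ∀ z ∈ effDom c, (∀ k, f k z ≤ 0) → ℓ z - lam * (c z).toReal ≤ M) :
    ∃ (τ : Fin K → ℝ) (ζL ζC : E) (ζF : Fin K → E), (∀ k, 0 ≤ τ k) ∧
      ζL + ζC + ∑ k, ζF k = 0 ∧
      conj (fun z => ((-ℓ z : ℝ) : EReal)) ζL + perspective (conj c) ζC lam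
        + ∑ k, perspective (conj (f k)) (ζF k) (τ k) ≤ (M : EReal) := by
  -- Each function has its own copy of the variable, confined to its own domain; `T` measures the
  -- disagreement. The domains therefore still count when `lam` or `τ k` is zero, as the perspective
  -- at zero requires.
  let D : Set (E × E × (Fin K → E)) := {v | v.2.1 ∈ effDom c ∧ ∀ k, v.2.2 k ∈ effDom (f k)}
  let T : (E × E × (Fin K → E)) →ₗ[ℝ] E × (Fin K → E) :=
    { toFun := fun v => (v.2.1 - v.1, fun k => v.2.2 k - v.1)
      map_add' := fun v w => by
        ext1
        · simp only [Prod.fst_add, Prod.snd_add]; abel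
        · funext k; simp only [Prod.fst_add, Prod.snd_add, Pi.add_apply]; abel
      map_smul' := fun a v => by
        ext1
        · simp [smul_sub]
        · funext k; simp [smul_sub] }
  have hcT := hc.convexOn_toReal hc0
  have hfT := fun k => (hf k).convexOn_toReal (hf0 k)
  have hDconv : Convex ℝ D := fun v hv w hw a b ha hb hab =>
    ⟨hcT.1 hv.1 hw.1 ha hb hab, fun k => (hfT k).1 (hv.2 k) (hw.2 k) ha hb hab⟩
  let φ : E × E × (Fin K → E) → ℝ := fun v => M - ℓ v.1 + lam * (c v.2.1).toReal
  have hφ : ConvexOn ℝ D φ := by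
    refine ⟨hDconv, fun v hv w hw a b ha hb hab => ?_⟩
    have h1 := hℓ.2 (Set.mem_univ v.1) (Set.mem_univ w.1) ha hb hab
    have h2 := mul_le_mul_of_nonneg_left (hcT.2 hv.1 hw.1 ha hb hab) hlam
    simp only [smul_eq_mul] at h1 h2
    have h3 : M = a * M + b * M := by rw [← add_mul, hab, one_mul]
    simp only [φ, smul_eq_mul, Prod.fst_add, Prod.snd_add, Prod.smul_fst, Prod.smul_snd]
    linarith
  let h : Fin K → E × E × (Fin K → E) → ℝ := fun k v => (f k (v.2.2 k)).toReal
  have hh : ∀ k, ConvexOn ℝ D (h k) := fun k =>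
    ⟨hDconv, fun v hv w hw a b ha hb hab => (hfT k).2 (hv.2 k) (hw.2 k) ha hb hab⟩
  let v₀ : E × E × (Fin K → E) := (x₀, x₀, fun _ => x₀)
  have hv₀ : IsCorePoint D v₀ := by
    refine ⟨⟨hcx.1, fun k => (hfx k).1⟩, fun v hv => ?_⟩
    have h1 := hcx.eventually hcT.1 hv.1
    have h2 := Filter.eventually_all.2 fun k => (hfx k).eventually (hfT k).1 (hv.2 k)
    obtain ⟨r, ⟨hr1, hr2⟩, hr⟩ := ((h1.and h2).and self_mem_nhdsWithin).exists
    exact ⟨r, hr, hr1, hr2⟩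
  have hTv₀ : T v₀ = 0 := by
    change ((x₀ - x₀, fun _ => x₀ - x₀) : E × (Fin K → E)) = 0
    rw [sub_self]
    rfl
  have hT0 : ∀ v, T v = 0 → v.2.1 = v.1 ∧ ∀ k, v.2.2 k = v.1 := by
    intro v hv
    exact ⟨sub_eq_zero.1 (congrArg Prod.fst hv),
      fun k => sub_eq_zero.1 (congrFun (congrArg Prod.snd hv) k)⟩
  have hTaff := T.isAffineOn D
  have hsub : {v ∈ D | T v = 0} ⊆ D := fun v hv => hv.1
  have hconv1 := hTaff.convex_zero hDconv
  -- The inequalities are priced on the diagonal `T v = 0`; only afterwards is the diagonal itself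
  -- relaxed by `η`.
  obtain ⟨τ, hτ, hτ'⟩ := exists_multipliers h Finset.univ {v ∈ D | T v = 0} φ v₀
    (hφ.subset hsub hconv1) (hv₀.zero_set hTaff hTv₀)
    (fun k _ => by
      have hx0k := hfx0 k
      refine ⟨(hh k).subset hsub hconv1, ?_, ?_⟩
      · change (f k x₀).toReal ≤ 0
        rw [← coe_toReal_of_mem_effDom (hf0 k) (hfx k).1] at hx0k
        exact_mod_cast hx0k
      · by_cases haff : IsAffineFn (f k)
        · right
          obtain ⟨a, β, hab⟩ := haff
          have hk : h k = fun v => inner ℝ a (v.2.2 k) + β := by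
            funext v
            simp only [h, hab, EReal.toReal_coe]
          rw [hk]
          intro v _ w _ s t _ _ hst
          simp only [Prod.snd_add, Prod.smul_snd, Pi.add_apply, Pi.smul_apply, inner_add_right,
            inner_smul_right, smul_eq_mul]
          have : β = s * β + t * β := by rw [← add_mul, hst, one_mul]
          linarith
        · left
          have h1 := hstrict k haff
          change (f k x₀).toReal < 0
          rw [← coe_toReal_of_mem_effDom (hf0 k) (hfx k).1] at h1
          exact_mod_cast h1)
    (fun v hv hvk => by
      obtain ⟨e1, e2⟩ := hT0 v hv.2
      have h1 := hM v.1 (e1 ▸ hv.1.1) (fun k => by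
        have h2 := hvk k (Finset.mem_univ k)
        simp only [h, e2] at h2
        have h3 : v.1 ∈ effDom (f k) := e2 k ▸ hv.1.2 k
        rw [← coe_toReal_of_mem_effDom (hf0 k) h3]
        exact_mod_cast h2)
      simp only [φ, e1]
      linarith)
  obtain ⟨η, hη⟩ := exists_linear_le_of_nonneg_on_zero
    (convexOn_add_sum hφ Finset.univ hτ fun k _ => hh k) hTaff hv₀ hTv₀
    (fun v hv hv0 => hτ' v ⟨hv, hv0⟩)
  have riesz : ∀ l : E →ₗ[ℝ] ℝ, ∃ y : E, ∀ z, inner ℝ y z = l z := fun l =>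
    ⟨(InnerProductSpace.toDual ℝ E).symm (LinearMap.toContinuousLinearMap l), fun z => by simp⟩
  obtain ⟨ζC, hζC⟩ := riesz (η.comp (LinearMap.inl ℝ E (Fin K → E)))
  choose ζF hζF using fun k =>
    riesz (η.comp ((LinearMap.inr ℝ E (Fin K → E)).comp (LinearMap.single ℝ (fun _ => E) k)))
  have hηeq : ∀ (w : E) (u : Fin K → E), η (w, u) = inner ℝ ζC w + ∑ k, inner ℝ (ζF k) (u k) := by
    intro w u
    simp only [hζC, hζF, LinearMap.comp_apply, LinearMap.inl_apply, LinearMap.inr_apply,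
      LinearMap.single_apply]
    rw [← map_sum, ← map_add]
    congr 1
    have : ∑ k, ((0 : E), (Pi.single k (u k) : Fin K → E)) = (0, u) := by
      have := map_sum (LinearMap.inr ℝ E (Fin K → E)) (fun k => (Pi.single k (u k) : Fin K → E))
        Finset.univ
      rw [Finset.univ_sum_single] at this
      simpa using this.symm
    rw [this]
    simp
  -- Here `none` indexes the loss, `some none` the cost and `some (some k)` the constraint `f k`.
  -- The inequality for `η` bounds a sum over independent copies, so it splits into separate
  -- suprema.
  let A : ∀ _ : Option (Option (Fin K)), Set E := fun o =>
    match o with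
    | none => Set.univ
    | some none => effDom c
    | some (some k) => effDom (f k)
  let F : ∀ _ : Option (Option (Fin K)), E → ℝ := fun o =>
    match o with
    | none => fun z => inner ℝ (-(ζC + ∑ k, ζF k)) z - -ℓ z
    | some none => fun z => inner ℝ ζC z - lam * (c z).toReal
    | some (some k) => fun z => inner ℝ (ζF k) z - τ k * (f k z).toReal
  obtain ⟨r, hr, hrM⟩ := exists_bounds_of_sum_le A F
    (fun o => by
      match o with
      | none => exact Set.univ_nonempty
      | some none => exact ⟨x₀, hcx.1⟩
      | some (some k) => exact ⟨x₀, (hfx k).1⟩) M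
    (fun u hu => by
      have h1 := hη (u none, u (some none), fun k => u (some (some k)))
        ⟨hu (some none), fun k => hu (some (some k))⟩
      change η (u (some none) - u none, fun k => u (some (some k)) - u none) ≤ _ at h1
      rw [hηeq] at h1
      simp only [inner_sub_right, Finset.sum_sub_distrib, φ, h] at h1
      simp only [Fintype.sum_option, F, inner_neg_left, inner_add_left, sum_inner,
        Finset.sum_sub_distrib]
      linarith)
  refine ⟨τ, -(ζC + ∑ k, ζF k), ζC, ζF, hτ, by abel, ?_⟩
  rw [Fintype.sum_option, Fintype.sum_option] at hrM
  have h1 : conj (fun z => ((-ℓ z : ℝ) : EReal)) (-(ζC + ∑ k, ζF k)) ≤ (r none : EReal) :=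
    (conj_coe_le_iff _ _ _).2 fun z => hr none z trivial
  have h2 : perspective (conj c) ζC lam ≤ (r (some none) : EReal) :=
    (perspective_conj_le_iff hc0 hc hcx hlam ζC _).2 (hr (some none))
  have h3 : ∀ k, perspective (conj (f k)) (ζF k) (τ k) ≤ (r (some (some k)) : EReal) := fun k =>
    (perspective_conj_le_iff (hf0 k) (hf k) (hfx k) (hτ k) (ζF k) _).2 (hr (some (some k)))
  refine (add_le_add (add_le_add h1 h2) (Finset.sum_le_sum fun k _ => h3 k)).trans ?_
  rw [← EReal.coe_finset_sum, ← EReal.coe_add, ← EReal.coe_add, EReal.coe_le_coe_iff]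
  linarith

end InnerDuality

/-! ### Expectations -/

section Expectation

variable {Ω X : Type*} [MeasurableSpace Ω] [MeasurableSpace X] {μ : Measure Ω}

theorem expectation_map {T : X → Ω} {ν : Measure X} (hT : Measurable T) {f : Ω → ℝ}
    (hf : AEMeasurable f (ν.map T)) : expectation (ν.map T) f = expectation ν (fun x => f (T x)) := by
  have hneg : AEMeasurable (fun z => ENNReal.ofReal (-f z)) (ν.map T) := hf.neg.ennreal_ofReal
  rw [expectation, expectation, lintegral_map' hf.ennreal_ofReal hT.aemeasurable,
    lintegral_map' hneg hT.aemeasurable]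

theorem coe_ennreal_eq_coe_toReal {a : ℝ≥0∞} (ha : a ≠ ⊤) : (a : EReal) = (a.toReal : EReal) := by
  lift a to NNReal using ha
  rfl

theorem expectation_eq_integral {f : Ω → ℝ} (hf : Integrable f μ) :
    expectation μ f = ((∫ z, f z ∂μ : ℝ) : EReal) := by
  have hneg : ∫⁻ z, ENNReal.ofReal (-f z) ∂μ < ⊤ := hf.neg.lintegral_lt_top
  rw [expectation, integral_eq_lintegral_pos_part_sub_lintegral_neg_part hf,
    coe_ennreal_eq_coe_toReal hf.lintegral_lt_top.ne, coe_ennreal_eq_coe_toReal hneg.ne,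
    EReal.coe_sub]

/-- If the negative part has infinite integral, the convention makes the expectation `⊥`. Otherwise
`f ≤ ψ + (f - ψ)⁺` makes `f` integrable, and ordinary linearity applies. -/
theorem expectation_le_of_lintegral_sub_le {f ψ : Ω → ℝ} (hf : AEMeasurable f μ)
    (hψ : Integrable ψ μ) {B : ℝ} (hB : 0 ≤ B)
    (h : ∫⁻ z, ENNReal.ofReal (f z - ψ z) ∂μ ≤ ENNReal.ofReal B) :
    expectation μ f ≤ ((∫ z, ψ z ∂μ + B : ℝ) : EReal) := by
  by_cases hneg : ∫⁻ z, ENNReal.ofReal (-f z) ∂μ = ⊤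
  · rw [expectation, hneg, EReal.coe_ennreal_top, EReal.sub_top]
    exact bot_le
  have hpos : ∫⁻ z, ENNReal.ofReal (f z) ∂μ ≠ ⊤ := by
    refine ne_top_of_le_ne_top (b := ∫⁻ z, ENNReal.ofReal (f z - ψ z) ∂μ
      + ∫⁻ z, ENNReal.ofReal (ψ z) ∂μ)
      (ENNReal.add_ne_top.2 ⟨ne_top_of_le_ne_top ENNReal.ofReal_ne_top h,
        hψ.lintegral_lt_top.ne⟩) ?_
    rw [← lintegral_add_right' _ hψ.aemeasurable.ennreal_ofReal]
    refine lintegral_mono fun z => ?_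
    refine le_trans (le_of_eq ?_) ENNReal.ofReal_add_le
    rw [sub_add_cancel]
  have hint : Integrable f μ := by
    refine ⟨hf.aestronglyMeasurable, ?_⟩
    rw [hasFiniteIntegral_iff_norm]
    have h1 : ∀ z, ENNReal.ofReal ‖f z‖ ≤ ENNReal.ofReal (f z) + ENNReal.ofReal (-f z) := by
      intro z
      rcases le_total 0 (f z) with h0 | h0
      · rw [Real.norm_of_nonneg h0]; exact le_self_add
      · rw [Real.norm_of_nonpos h0]; exact le_add_self
    refine (lintegral_mono h1).trans_lt ?_
    rw [lintegral_add_left' hf.ennreal_ofReal]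
    exact ENNReal.add_lt_top.2 ⟨lt_top_iff_ne_top.2 hpos, lt_top_iff_ne_top.2 hneg⟩
  rw [expectation_eq_integral hint, EReal.coe_le_coe_iff]
  have h1 : ∫ z, f z ∂μ = ∫ z, ψ z ∂μ + ∫ z, (f z - ψ z) ∂μ := by
    rw [integral_sub hint hψ]; ring
  rw [h1]
  have h2 : ∫ z, (f z - ψ z) ∂μ ≤ B := by
    have h5 : Integrable (fun z => f z - ψ z) μ := hint.sub hψ
    rw [integral_eq_lintegral_pos_part_sub_lintegral_neg_part h5]
    have h3 := ENNReal.toReal_le_of_le_ofReal hB h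
    have h4 : 0 ≤ (∫⁻ z, ENNReal.ofReal (-(f z - ψ z)) ∂μ).toReal := ENNReal.toReal_nonneg
    linarith
  linarith

end Expectation

/-! ### Bounds on the worst-case expectation -/

section Transport

variable {Ω : Type*} [MeasurableSpace Ω] [MeasurableSingletonClass Ω] {Z : Set Ω}
  {c : Ω → Ω → ℝ≥0∞} {J : ℕ} {p : Fin J → ℝ} {zhat : Fin J → Ω} {ε : ℝ} {ℓ : Ω → ℝ}

theorem ae_discreteMeasure_mem_range :
    ∀ᵐ w ∂(discreteMeasure p zhat), ∃ j, zhat j = w := by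
  have hm : MeasurableSet (Set.range zhat)ᶜ := (Set.finite_range zhat).measurableSet.compl
  change discreteMeasure p zhat (Set.range zhat)ᶜ = 0
  rw [discreteMeasure, Measure.finsetSum_apply]
  refine Finset.sum_eq_zero fun j _ => ?_
  rw [Measure.smul_apply, Measure.dirac_apply' _ hm]
  simp

theorem integrable_discreteMeasure (ψ : Ω → ℝ) : Integrable ψ (discreteMeasure p zhat) := by
  rw [discreteMeasure, integrable_finsetSum_measure]
  exact fun j _ => (integrable_dirac (by simp)).smul_measure ENNReal.ofReal_ne_top

theorem integral_discreteMeasure (hp : ∀ j, 0 ≤ p j) (ψ : Ω → ℝ) :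
    ∫ w, ψ w ∂(discreteMeasure p zhat) = ∑ j, p j * ψ (zhat j) := by
  rw [discreteMeasure, integral_finsetSum_measure
    fun j _ => (integrable_dirac (by simp)).smul_measure ENNReal.ofReal_ne_top]
  refine Finset.sum_congr rfl fun j _ => ?_
  rw [integral_smul_measure, integral_dirac, ENNReal.toReal_ofReal (hp j), smul_eq_mul]

/-- The pointwise bound ℓ(z) ≤ λ c(z,ẑ_j) + s_j is integrated against the coupling. Strict
positivity of `lam` keeps it valid at infinite cost, where `0 * ⊤ = 0` would break it. -/
theorem expectation_le_of_coupling (hp : ∀ j, 0 ≤ p j) {π : Measure (Ω × Ω)} {Q : Measure Ω}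
    [IsProbabilityMeasure Q] (hQZ : Q Zᶜ = 0) (hπ : π ∈ couplings Q (discreteMeasure p zhat))
    (hℓ : AEMeasurable ℓ Q) {lam : ℝ} (hlam : 0 < lam) {s : Fin J → ℝ}
    (hs : ∀ j, ∀ z ∈ Z, c z (zhat j) < ⊤ → ℓ z - lam * (c z (zhat j)).toReal ≤ s j)
    {B : ℝ} (hB : 0 ≤ B) (hcost : ∫⁻ w, c w.1 w.2 ∂π ≤ ENNReal.ofReal B) :
    expectation Q ℓ ≤ ((lam * B + ∑ j, p j * s j : ℝ) : EReal) := by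
  obtain ⟨hπ1, hπ2⟩ := hπ
  -- The points `zhat j` may coincide, so the bound must depend on the point: the least `s j` over
  -- its indices. Elsewhere the empty infimum is `0`, on a null set.
  let ψ : Ω → ℝ := fun w => ⨅ j : {j // zhat j = w}, s j
  have hψs : ∀ j, ψ (zhat j) ≤ s j := fun j =>
    ciInf_le (Set.finite_range fun i : {i // zhat i = zhat j} => s i).bddBelow ⟨j, rfl⟩
  have hψ : ∀ j, ∀ z ∈ Z, c z (zhat j) < ⊤ →
      ℓ z - lam * (c z (zhat j)).toReal ≤ ψ (zhat j) := by
    intro j z hz hcz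
    have : Nonempty {i // zhat i = zhat j} := ⟨⟨j, rfl⟩⟩
    refine le_ciInf fun i => ?_
    have h1 := hs i.1 z hz
    rw [i.2] at h1
    exact h1 hcz
  have hZ : ∀ᵐ w ∂π, w.1 ∈ Z := by
    refine ae_of_ae_map (p := fun z => z ∈ Z) measurable_fst.aemeasurable ?_
    rw [hπ1]
    exact hQZ
  have hR : ∀ᵐ w ∂π, ∃ j, zhat j = w.2 := by
    refine ae_of_ae_map (p := fun w => ∃ j, zhat j = w) measurable_snd.aemeasurable ?_
    rw [hπ2]
    exact ae_discreteMeasure_mem_range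
  have hψint : Integrable (fun w : Ω × Ω => ψ w.2) π := by
    have h1 := integrable_discreteMeasure (p := p) (zhat := zhat) ψ
    rw [← hπ2] at h1
    exact h1.comp_measurable measurable_snd
  have hψeq : ∫ w, ψ w.2 ∂π = ∑ j, p j * ψ (zhat j) := by
    have h1 := integrable_discreteMeasure (p := p) (zhat := zhat) ψ
    rw [← hπ2] at h1
    rw [← integral_discreteMeasure hp, ← hπ2,
      integral_map measurable_snd.aemeasurable h1.aestronglyMeasurable]
  have hle : ∫⁻ w, ENNReal.ofReal (ℓ w.1 - ψ w.2) ∂π ≤ ENNReal.ofReal (lam * B) := by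
    have h1 : ∀ᵐ w ∂π, ENNReal.ofReal (ℓ w.1 - ψ w.2) ≤ ENNReal.ofReal lam * c w.1 w.2 := by
      filter_upwards [hZ, hR] with w hw1 ⟨j, hj⟩
      rw [← hj]
      by_cases hcw : c w.1 (zhat j) = ⊤
      · rw [hcw, ENNReal.mul_top (by simpa using hlam)]
        exact le_top
      · rw [← ENNReal.ofReal_toReal hcw, ← ENNReal.ofReal_mul hlam.le]
        refine ENNReal.ofReal_le_ofReal ?_
        linarith [hψ j w.1 hw1 (lt_top_iff_ne_top.2 hcw)]
    refine (lintegral_mono_ae h1).trans ?_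
    rw [lintegral_const_mul' _ _ ENNReal.ofReal_ne_top, ENNReal.ofReal_mul hlam.le]
    gcongr
  have hℓπ : AEMeasurable ℓ (π.map Prod.fst) := by rwa [hπ1]
  have h2 := expectation_le_of_lintegral_sub_le (f := fun w : Ω × Ω => ℓ w.1)
    (hℓπ.comp_measurable measurable_fst) hψint (mul_nonneg hlam.le hB) hle
  rw [← expectation_map measurable_fst hℓπ, hπ1] at h2
  refine h2.trans (EReal.coe_le_coe_iff.2 ?_)
  rw [hψeq, add_comm]
  gcongr with j _
  · exact hp j
  · exact hψs j

/-- Weak duality for the worst-case expectation. -/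
theorem expectation_le_of_mem_ambiguitySet (hp : ∀ j, 0 ≤ p j) (hε : 0 ≤ ε) {Q : Measure Ω}
    (hQ : Q ∈ ambiguitySet Z c (discreteMeasure p zhat) ε) (hℓ : AEMeasurable ℓ Q)
    {lam : ℝ} (hlam : 0 ≤ lam) {s : Fin J → ℝ}
    (hs : ∀ j, ∀ z ∈ Z, c z (zhat j) < ⊤ → ℓ z - lam * (c z (zhat j)).toReal ≤ s j) :
    expectation Q ℓ ≤ ((lam * ε + ∑ j, p j * s j : ℝ) : EReal) := by
  obtain ⟨hQ1, hQ2, hQ3⟩ := hQ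
  -- Raising `lam` makes it positive; raising `ε` is needed because an optimal coupling may not
  -- exist.
  have key : ∀ δ : ℝ, 0 < δ → expectation Q ℓ
      ≤ (((lam + δ) * (ε + δ) + ∑ j, p j * s j : ℝ) : EReal) := by
    intro δ hδ
    have h1 : otDiscrepancy c Q (discreteMeasure p zhat) < ENNReal.ofReal (ε + δ) :=
      hQ3.trans_lt ((ENNReal.ofReal_lt_ofReal_iff (by linarith)).2 (by linarith))
    rw [otDiscrepancy] at h1
    simp only [iInf_lt_iff] at h1
    obtain ⟨π, hπ, hlt⟩ := h1
    refine expectation_le_of_coupling hp hQ2 hπ hℓ (by linarith) (fun j z hz hcz => ?_)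
      (by linarith) hlt.le
    have h2 := hs j z hz hcz
    have h3 : 0 ≤ δ * (c z (zhat j)).toReal := mul_nonneg hδ.le ENNReal.toReal_nonneg
    linarith
  refine EReal.le_of_forall_lt_iff_le.1 fun r hr => ?_
  rw [EReal.coe_lt_coe_iff] at hr
  set g := r - (lam * ε + ∑ j, p j * s j) with hg
  have hgpos : 0 < g := by linarith
  have hden : 0 < lam + ε + 1 := by linarith
  -- For `δ ≤ 1` the excess `δ * (lam + ε + δ)` is at most `δ * (lam + ε + 1) ≤ g`.
  have hδ : 0 < min 1 (g / (lam + ε + 1)) := lt_min one_pos (div_pos hgpos hden)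
  refine (key _ hδ).trans (EReal.coe_le_coe_iff.2 ?_)
  set δ := min 1 (g / (lam + ε + 1))
  have h1 : δ ≤ 1 := min_le_left _ _
  have h2 : δ * (lam + ε + 1) ≤ g := (le_div_iff₀ hden).1 (min_le_right _ _)
  nlinarith

/-- The cost and reward pairs dominated by those of a distribution on `Z` that is transported
to the point `w`. -/
def attainablePairs (Z : Set Ω) (c : Ω → Ω → ℝ≥0∞) (ℓ : Ω → ℝ) (w : Ω) : Set (ℝ × ℝ) :=
  {q | 0 ≤ q.1 ∧ ∃ μ : Measure Ω, IsProbabilityMeasure μ ∧ μ Zᶜ = 0 ∧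
    ∫⁻ z, c z w ∂μ ≤ ENNReal.ofReal q.1 ∧ Integrable ℓ μ ∧ q.2 ≤ ∫ z, ℓ z ∂μ}

omit [MeasurableSingletonClass Ω] in
-- Cost and reward are linear in the distribution, so mixtures realize convex combinations.
theorem convex_attainablePairs (w : Ω) : Convex ℝ (attainablePairs Z c ℓ w) := by
  rintro q ⟨hq, μ, hμ, hμZ, hμc, hμi, hμl⟩ q' ⟨hq', ν, hν, hνZ, hνc, hνi, hνl⟩ a b ha hb hab
  refine ⟨add_nonneg (mul_nonneg ha hq) (mul_nonneg hb hq'),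
    ENNReal.ofReal a • μ + ENNReal.ofReal b • ν, ⟨?_⟩, ?_, ?_, ?_, ?_⟩
  · simp [← ENNReal.ofReal_add ha hb, hab]
  · simp [hμZ, hνZ]
  · rw [lintegral_add_measure, lintegral_smul_measure, lintegral_smul_measure]
    change _ ≤ ENNReal.ofReal (a * q.1 + b * q'.1)
    rw [ENNReal.ofReal_add (mul_nonneg ha hq) (mul_nonneg hb hq'), ENNReal.ofReal_mul ha,
      ENNReal.ofReal_mul hb, smul_eq_mul, smul_eq_mul]
    gcongr
  · exact (hμi.smul_measure ENNReal.ofReal_ne_top).add_measure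
      (hνi.smul_measure ENNReal.ofReal_ne_top)
  · rw [integral_add_measure (hμi.smul_measure ENNReal.ofReal_ne_top)
      (hνi.smul_measure ENNReal.ofReal_ne_top), integral_smul_measure, integral_smul_measure,
      ENNReal.toReal_ofReal ha, ENNReal.toReal_ofReal hb]
    change a * q.2 + b * q'.2 ≤ a * _ + b * _
    gcongr

theorem mem_attainablePairs {w z : Ω} (hz : z ∈ Z) (hc : c z w < ⊤) :
    ((c z w).toReal, ℓ z) ∈ attainablePairs Z c ℓ w := by
  refine ⟨ENNReal.toReal_nonneg, Measure.dirac z, inferInstance, ?_, ?_,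
    integrable_dirac (by simp), by simp⟩
  · rw [Measure.dirac_apply]
    simp [hz]
  · rw [lintegral_dirac, ENNReal.ofReal_toReal hc.ne]

omit [MeasurableSingletonClass Ω] in
-- The coupling is the mixture of the products of `μ j` with the Dirac measure at `zhat j`.
theorem sum_smul_mem_ambiguitySet (hp : ∀ j, 0 ≤ p j) (hp_sum : ∑ j, p j = 1)
    {μ : Fin J → Measure Ω} [∀ j, IsProbabilityMeasure (μ j)] (hμZ : ∀ j, μ j Zᶜ = 0)
    {a : Fin J → ℝ} (ha : ∀ j, 0 ≤ a j)
    (hμc : ∀ j, ∫⁻ z, c z (zhat j) ∂(μ j) ≤ ENNReal.ofReal (a j)) (hsum : ∑ j, p j * a j ≤ ε) :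
    ∑ j, ENNReal.ofReal (p j) • μ j ∈ ambiguitySet Z c (discreteMeasure p zhat) ε := by
  refine ⟨⟨?_⟩, ?_, ?_⟩
  · simp only [Measure.finsetSum_apply, Measure.smul_apply, measure_univ, smul_eq_mul, mul_one]
    rw [← ENNReal.ofReal_sum_of_nonneg fun j _ => hp j, hp_sum, ENNReal.ofReal_one]
  · rw [Measure.finsetSum_apply]
    exact Finset.sum_eq_zero fun j _ => by simp [hμZ j]
  · have hmeas : ∀ j, Measurable fun z : Ω => (z, zhat j) := fun j =>
      measurable_id.prodMk measurable_const
    have hπ : ∑ j, ENNReal.ofReal (p j) • (μ j).map (fun z => (z, zhat j))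
        ∈ couplings (∑ j, ENNReal.ofReal (p j) • μ j) (discreteMeasure p zhat) := by
      refine ⟨?_, ?_⟩
      · rw [Measure.map_finset_sum' measurable_fst.aemeasurable]
        refine Finset.sum_congr rfl fun j _ => ?_
        rw [Measure.map_smul, Measure.map_map measurable_fst (hmeas j)]
        congr 1
        exact Measure.map_id
      · rw [Measure.map_finset_sum' measurable_snd.aemeasurable]
        refine Finset.sum_congr rfl fun j _ => ?_
        rw [Measure.map_smul, Measure.map_map measurable_snd (hmeas j)]
        congr 1
        change Measure.map (fun _ => zhat j) (μ j) = _
        rw [Measure.map_const, measure_univ, one_smul]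
    refine (iInf₂_le _ hπ).trans ?_
    rw [lintegral_finsetSum_measure]
    refine le_trans (Finset.sum_le_sum (g := fun j => ENNReal.ofReal (p j * a j))
      fun j _ => ?_) ?_
    · rw [lintegral_smul_measure, ENNReal.ofReal_mul (hp j), smul_eq_mul]
      gcongr
      -- This direction of the change of variables holds without measurability of the cost.
      exact (lintegral_map_le _ _).trans (hμc j)
    · rw [← ENNReal.ofReal_sum_of_nonneg fun j _ => mul_nonneg (hp j) (ha j)]
      exact ENNReal.ofReal_le_ofReal hsum

/-- Strong duality, with an attained multiplier, for the worst-case expectation. -/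
theorem exists_multiplier_of_expectation_le (hp : ∀ j, 0 < p j) (hp_sum : ∑ j, p j = 1)
    (hzhat : ∀ j, zhat j ∈ Z) (hc : ∀ j, c (zhat j) (zhat j) = 0) (hε : 0 < ε) {v : ℝ}
    (hv : ∀ Q ∈ ambiguitySet Z c (discreteMeasure p zhat) ε, expectation Q ℓ ≤ (v : EReal)) :
    ∃ (lam : ℝ) (s : Fin J → ℝ), 0 ≤ lam ∧
      (∀ j, ∀ z ∈ Z, c z (zhat j) < ⊤ → ℓ z - lam * (c z (zhat j)).toReal ≤ s j) ∧
      lam * ε + ∑ j, p j * s j ≤ v := by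
  let D : Set (Fin J → ℝ × ℝ) := {q | ∀ j, q j ∈ attainablePairs Z c ℓ (zhat j)}
  have hD : Convex ℝ D := fun q hq q' hq' a b ha hb hab j =>
    convex_attainablePairs (zhat j) (hq j) (hq' j) ha hb hab
  let φ : (Fin J → ℝ × ℝ) → ℝ := fun q => v - ∑ j, p j * (q j).2
  let h : (Fin J → ℝ × ℝ) → ℝ := fun q => ∑ j, p j * (q j).1 - ε
  have hφ : ConvexOn ℝ D φ := by
    refine IsAffineOn.convexOn hD fun q _ q' _ a b _ _ hab => ?_
    have h1 : v = a * v + b * v := by rw [← add_mul, hab, one_mul]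
    have h2 : ∀ j, p j * ((a • q + b • q') j).2 = a * (p j * (q j).2) + b * (p j * (q' j).2) :=
      fun j => by simp; ring
    simp only [φ, h2, Finset.sum_add_distrib, ← Finset.mul_sum, smul_eq_mul]
    linarith
  have hh : ConvexOn ℝ D h := by
    refine IsAffineOn.convexOn hD fun q _ q' _ a b _ _ hab => ?_
    have h1 : ε = a * ε + b * ε := by rw [← add_mul, hab, one_mul]
    have h2 : ∀ j, p j * ((a • q + b • q') j).1 = a * (p j * (q j).1) + b * (p j * (q' j).1) :=
      fun j => by simp; ring
    simp only [h, h2, Finset.sum_add_distrib, ← Finset.mul_sum, smul_eq_mul]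
    linarith
  have hmem : ∀ u : Fin J → Ω, (∀ j, u j ∈ {z | z ∈ Z ∧ c z (zhat j) < ⊤}) →
      (fun j => ((c (u j) (zhat j)).toReal, ℓ (u j))) ∈ D := fun u hu j =>
    mem_attainablePairs (hu j).1 (hu j).2
  have hfin : ∀ j, zhat j ∈ {z | z ∈ Z ∧ c z (zhat j) < ⊤} := fun j =>
    ⟨hzhat j, by rw [hc j]; exact ENNReal.zero_lt_top⟩
  -- Leaving all mass in place has cost zero, below the budget: the strictly feasible point.
  obtain ⟨lam, hlam, hle⟩ := exists_multiplier_of_strict hφ hh (hmem zhat hfin)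
    (by simp [h, hc, hε]) (fun q hq hq0 => by
      choose hq1 μ hμ hμZ hμc hμi hμl using hq
      have h1 := hv _ (sum_smul_mem_ambiguitySet (fun j => (hp j).le) hp_sum hμZ hq1 hμc
        (sub_nonpos.1 hq0))
      have h2 : ∀ j ∈ Finset.univ, Integrable ℓ (ENNReal.ofReal (p j) • μ j) := fun j _ =>
        (hμi j).smul_measure ENNReal.ofReal_ne_top
      rw [expectation_eq_integral (integrable_finsetSum_measure.2 h2), EReal.coe_le_coe_iff,
        integral_finsetSum_measure h2] at h1
      refine sub_nonneg.2 (le_trans (Finset.sum_le_sum fun j _ => ?_) h1)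
      rw [integral_smul_measure, ENNReal.toReal_ofReal (hp j).le, smul_eq_mul]
      exact mul_le_mul_of_nonneg_left (hμl j) (hp j).le)
  -- On Dirac measures the Lagrangian bound is a sum over freely chosen points `u j`, so it splits;
  -- dividing by `p j` gives `s j`.
  obtain ⟨r, hr, hrv⟩ := exists_bounds_of_sum_le (fun j => {z | z ∈ Z ∧ c z (zhat j) < ⊤})
    (fun j z => p j * (ℓ z - lam * (c z (zhat j)).toReal)) (fun j => ⟨_, hfin j⟩) (v - lam * ε)
    (fun u hu => by
      have h1 := hle _ (hmem u hu)
      have h2 : ∀ j, p j * (ℓ (u j) - lam * (c (u j) (zhat j)).toReal)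
          = p j * ℓ (u j) - lam * (p j * (c (u j) (zhat j)).toReal) := fun j => by ring
      simp only [h2, Finset.sum_sub_distrib, ← Finset.mul_sum]
      simp only [φ, h] at h1
      linarith)
  refine ⟨lam, fun j => r j / p j, hlam, fun j z hz hcz => ?_, ?_⟩
  · rw [le_div_iff₀ (hp j), mul_comm]
    exact hr j z ⟨hz, hcz⟩
  · have h1 : ∀ j, p j * (r j / p j) = r j := fun j => mul_div_cancel₀ _ (hp j).ne'
    simp only [h1]
    linarith

end Transport

/-! ### Measurability of the loss, and the main theorem. -/

/-- A pointwise maximum of finitely many upper semicontinuous functions is almost everywhere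
measurable with respect to every measure carried by the set where it is given. -/
theorem aemeasurable_of_isGreatest {Ω : Type*} [TopologicalSpace Ω] [MeasurableSpace Ω]
    [OpensMeasurableSpace Ω] {I : ℕ} {Z : Set Ω} {Q : Measure Ω} (hQ : Q Zᶜ = 0) {ℓ : Ω → ℝ}
    {ℓs : Fin I → Ω → ℝ} (hℓ : ∀ z ∈ Z, IsGreatest (Set.range fun i => ℓs i z) (ℓ z))
    (husc : ∀ i, UpperSemicontinuous (ℓs i)) : AEMeasurable ℓ Q := by
  refine ⟨fun z => ⨆ i, ℓs i z, Measurable.iSup fun i => (husc i).measurable, ?_⟩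
  have hZ : ∀ᵐ z ∂Q, z ∈ Z := hQ
  filter_upwards [hZ] with z hz
  exact (hℓ z hz).csSup_eq.symm

theorem proposition2p11 {m d I J K L : ℕ}
    -- the feasible set `Θ = {g_l ≤ 0}`
    (g : Fin L → EuclideanSpace ℝ (Fin m) → EReal)
    (Θ : Set (EuclideanSpace ℝ (Fin m))) (hΘ : Θ = constraintSet g)
    (hg : ∀ l, IsProperConvexLsc (g l))
    -- the support set `Z = {f_k ≤ 0}`
    (f : Fin K → EuclideanSpace ℝ (Fin d) → EReal)
    (Z : Set (EuclideanSpace ℝ (Fin d))) (hZ : Z = constraintSet f)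
    (hf : ∀ k, IsProperConvexLsc (f k))
    -- the transportation cost
    (c : EuclideanSpace ℝ (Fin d) → EuclideanSpace ℝ (Fin d) → ℝ≥0∞)
    (hc_indisc : ∀ z ∈ Z, ∀ w ∈ Z, c z w = 0 ↔ z = w)
    (hc_lsc : LowerSemicontinuousOn
      (fun q : EuclideanSpace ℝ (Fin d) × EuclideanSpace ℝ (Fin d) => c q.1 q.2)
      (Set.univ ×ˢ Z))
    (hc_convex : ∀ w ∈ Z, IsConvexFn fun z => (c z w : EReal))
    -- the loss, a pointwise maximum of finitely many (finite-valued) saddle functions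
    (ℓ : EuclideanSpace ℝ (Fin m) → EuclideanSpace ℝ (Fin d) → ℝ)
    (ℓs : Fin I → EuclideanSpace ℝ (Fin m) → EuclideanSpace ℝ (Fin d) → ℝ)
    (hℓ : ∀ θ ∈ Θ, ∀ z ∈ Z, IsGreatest (Set.range fun i => ℓs i θ z) (ℓ θ z))
    (hℓ_theta : ∀ i z, ConvexOn ℝ Θ (fun θ => ℓs i θ z) ∧
      LowerSemicontinuousOn (fun θ => ℓs i θ z) Θ)
    (hℓ_z : ∀ i, ∀ θ ∈ Θ, ConcaveOn ℝ Set.univ (ℓs i θ) ∧ UpperSemicontinuous (ℓs i θ))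
    -- the discrete reference distribution
    (p : Fin J → ℝ) (hp : ∀ j, 0 < p j) (hp_sum : ∑ j, p j = 1)
    (zhat : Fin J → EuclideanSpace ℝ (Fin d)) (hzhat : ∀ j, zhat j ∈ Z)
    -- the Slater condition on the support set
    (hSlater : ∀ j, zhat j ∈ intrinsicInterior ℝ (effDom fun z => (c z (zhat j) : EReal)) ∧
      IsSlaterPoint f (zhat j))
    (ε : ℝ) (hε : 0 < ε) :
    -- the finite program is convex
    (Convex ℝ (primalGround Θ : Set (PrimalVar m d I J K)) ∧
      (∀ i j, IsConvexFnOn (primalGround Θ) (primalLHS ℓs c f zhat i j)) ∧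
      Convex ℝ (primalFeasible Θ ℓs c f zhat) ∧
      ConvexOn ℝ Set.univ (primalObjective ε p : PrimalVar m d I J K → ℝ)) ∧
    -- and has the same infimum as the distributionally robust problem
    droValue Θ Z ℓ c (discreteMeasure p zhat) ε =
      ⨅ x ∈ primalFeasible Θ ℓs c f zhat, (primalObjective ε p x : EReal) := by
  have hc0 : ∀ j z, (⊥ : EReal) < (c z (zhat j) : EReal) := fun j z => coe_ennreal_bot_lt _
  have hc := fun j => hc_convex (zhat j) (hzhat j)
  have hc' := fun j => isCorePoint_of_mem_intrinsicInterior (hSlater j).1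
  have hf0 := fun k => (hf k).proper.1
  have hfc := fun k => (hf k).convex
  have hf' := fun k j => isCorePoint_of_mem_intrinsicInterior ((hSlater j).2.mem_ri k)
  have hΘc : Convex ℝ Θ := by
    have h1 : Θ = ⋂ l, {θ | g l θ ≤ ((0 : ℝ) : EReal)} := by
      rw [hΘ]
      ext θ
      simp [constraintSet]
    rw [h1]
    exact convex_iInter fun l => (hg l).convex.convex_sublevel 0
  have hLHS := isConvexFnOn_primalLHS hΘc (fun i z => (hℓ_theta i z).1) hc hc' hf0 hfc hf'
  have hmemZ : ∀ z, z ∈ Z ↔ ∀ k, f k z ≤ 0 := fun z => by rw [hZ]; rfl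
  have htop : ∀ j z, z ∈ effDom (fun z => (c z (zhat j) : EReal)) ↔ c z (zhat j) < ⊤ := by
    intro j z
    change (c z (zhat j) : EReal) < ⊤ ↔ _
    rw [← EReal.coe_ennreal_top, EReal.coe_ennreal_lt_coe_ennreal_iff]
  refine ⟨⟨convex_primalGround hΘc, hLHS, convex_primalFeasible hΘc hLHS,
    convexOn_primalObjective ε p⟩, le_antisymm ?_ ?_⟩
  · refine le_iInf₂ fun x hx => (iInf₂_le x.theta hx.1.1).trans (iSup₂_le fun Q hQ => ?_)
    refine expectation_le_of_mem_ambiguitySet (fun j => (hp j).le) hε.le hQ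
      (aemeasurable_of_isGreatest hQ.2.1 (hℓ x.theta hx.1.1) fun i => (hℓ_z i x.theta hx.1.1).2)
      hx.1.2.1 fun j z hz hcz => ?_
    obtain ⟨i, hi⟩ := (hℓ x.theta hx.1.1 z hz).1
    rw [← hi]
    have h1 := sub_mul_le_of_conj_add_perspective_le (hc0 j) (hc j) (hc' j) hf0 hfc
      (fun k => hf' k j) hx.1.2.1 (hx.1.2.2 i j) (hx.2.2 i j) (hx.2.1 i j) ((htop j z).2 hcz)
      ((hmemZ z).1 hz)
    simpa using h1
  -- Real `v` strictly above the supremum settle the infinite cases too: none exists for `⊤`, all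
  -- qualify for `⊥`.
  · refine le_iInf₂ fun θ hθ => EReal.le_of_forall_lt_iff_le.1 fun v hv => ?_
    obtain ⟨lam, s, hlam, hs, hval⟩ := exists_multiplier_of_expectation_le (c := c) hp hp_sum
      hzhat (fun j => (hc_indisc _ (hzhat j) _ (hzhat j)).2 rfl) hε
      fun Q hQ => (le_iSup₂ (f := fun Q _ => expectation Q (ℓ θ)) Q hQ).trans hv.le
    -- The same `lam` must serve all `i` and `j`, so the inner duality is applied with `lam` already
    -- fixed.
    choose τ ζL ζC ζF hτ hζ hle using fun i j =>
      exists_conj_add_perspective_le (ℓ := ℓs i θ) (hℓ_z i θ hθ).1 (hc0 j) (hc j) (hc' j) hf0 hfc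
        (fun k => hf' k j) ((hmemZ _).1 (hzhat j)) (hSlater j).2.strict hlam (M := s j)
        (fun z hz hfz => by
          have hzZ := (hmemZ z).2 hfz
          have h1 := hs j z hzZ ((htop j z).1 hz)
          have h2 := (hℓ θ hθ z hzZ).2 ⟨i, rfl⟩
          simp only [EReal.toReal_coe_ennreal] at h1 h2 ⊢
          linarith)
    refine (iInf₂_le ((θ, lam, τ, s, ζL, ζC, ζF) : PrimalVar m d I J K)
      ⟨⟨hθ, hlam, hτ⟩, hle, hζ⟩).trans (EReal.coe_le_coe_iff.2 hval)
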